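/- Write $L(d_1,d_2)$ for the linear operators on $\mathbb C^{d_1}\otimes\mathbb C^{d_2}$, viewed as $d_1\times d_1$ block matrices $C=[C_{ij}]$ with blocks of size $d_2\times d_2$ (that is, the basis $e_i\otimes e_a$ is ordered lexicographically), and put $\operatorname{tr}_1 C=\sum_i C_{ii}\in L(\mathbb C^{d_2})$, $(\operatorname{tr}_2 C)_{ij}=\operatorname{tr}[C_{ij}]$, so that $\operatorname{tr}_2 C\in L(\mathbb C^{d_1})$. For a square complex matrix $A$ let $\sigma(A)$ be the vector of its singular values, with multiplicity and in decreasing order. For $C\in L(d_1,d_2)$ let $\sigma_1\ge\dots\ge\sigma_{d_1d_2}$ be its singular values and $\Sigma=\operatorname{diag}(\sigma_1,\dots,\sigma_{d_1d_2})\in L(d_1,d_2)$. For $x,y\in\mathbb R^n$ write $x\preceq_w y$ if for every $1\le k\le n$ the sum of the $k$ largest entries of $x$ is at most the sum of the $k$ largest entries of $y$. **(A)** Let $k_1\le d_2$ and $k_2\le d_1$, let $W_1,\dots,W_{k_1}$ be unitary $d_1\times d_1$ matrices and $\widetilde W_1,\dots,\widetilde W_{k_2}$ unitary $d_2\times d_2$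 matrices. Let $P_i\in L(\mathbb C^{d_2})$ and $Q_j\in L(\mathbb C^{d_1})$ be the diagonal matrices whose only nonzero entry is a $1$ at the $i$-th, respectively $j$-th, diagonal position. Then $S=\sum_{i=1}^{k_1}W_i\otimes P_i+\sum_{j=1}^{k_2}Q_j\otimes\widetilde W_j$ satisfies $$\sigma(S)\preceq_w(\underbrace{2,\dots,2}_{k_1k_2},\underbrace{1,\dots,1}_{k_1d_1+k_2d_2-2k_1k_2},0,\dots,0)\in\mathbb R^{d_1d_2}.$$ **(B)** Let $d\ge2$ and let $C\in L(d,d)$ satisfy $\sigma_n=\dots=\sigma_{d^2-4+n}$ for some $n\in\{1,2,3,4\}$. Then $$\sigma(\operatorname{tr}_1C\oplus\operatorname{tr}_2C)\preceq_w\sigma(\operatorname{tr}_1\Sigma\oplus\operatorname{tr}_2\Sigma).$$ **(C)** Let $d_1,d_2\ge2$ and let $C\in L(d_1,d_2)$ satisfy one of the following: (1) $\operatorname{rank}C\le3$, where in addition at least one of $d_1\le d_2$ and $d_2\ge3$ holds; (2) $\sigma_2=\dots=\sigma_{d_1d_2-1}$. Then $$\sigma(\operatorname{tr}_1C\oplus\operatorname{tr}_2C)\preceq_w\sigma(\operatorname{tr}_1\Sigma\oplus\operatorname{tr}_2\Sigma).$$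 -/

import Mathlib

namespace PartialTraceSVD

open scoped Kronecker

/-- The decreasing rearrangement `x↓` of a real vector `x`. -/
noncomputable def decr {n : ℕ} (x : Fin n → ℝ) : Fin n → ℝ :=
  x ∘ Tuple.sort (fun i => OrderDual.toDual (x i))

theorem decr_antitone {n : ℕ} (x : Fin n → ℝ) : Antitone (decr x) :=
  fun _ _ h => Tuple.monotone_sort (fun i => OrderDual.toDual (x i)) h

/-- Weak majorization: for every `1 ≤ k ≤ n`, the sum of the `k` largest entries of `x` is at
most the sum of the `k` largest entries of `y`. -/
def WeakMaj {n : ℕ} (x y : Fin n → ℝ) : Prop :=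
  ∀ k : ℕ, 1 ≤ k → k ≤ n →
    ∑ i ∈ Finset.univ.filter (fun i : Fin n => (i : ℕ) < k), decr x i ≤
      ∑ i ∈ Finset.univ.filter (fun i : Fin n => (i : ℕ) < k), decr y i

/-- The sequence of singular values of a square complex matrix, in decreasing order (counted with
multiplicity, starting at index `0`, and extended by `0` past the size of the matrix). -/
noncomputable def singSeq {ι : Type*} [Fintype ι] [DecidableEq ι] (A : Matrix ι ι ℂ) : ℕ → ℝ :=
  fun i => (Matrix.toEuclideanLin A).singularValues i

/-- The vector `σ(A)` of singular values of `A`; it has as many entries as `A` has rows. -/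
noncomputable def sing {ι : Type*} [Fintype ι] [DecidableEq ι] (A : Matrix ι ι ℂ) :
    Fin (Fintype.card ι) → ℝ :=
  fun i => singSeq A i

/-- `tr₁`: the sum of the diagonal blocks. -/
def tr1 {d1 d2 : ℕ} (C : Matrix (Fin d1 × Fin d2) (Fin d1 × Fin d2) ℂ) :
    Matrix (Fin d2) (Fin d2) ℂ :=
  Matrix.of fun a b => ∑ i : Fin d1, C (i, a) (i, b)

/-- `tr₂`: the matrix of the traces of the blocks. -/
def tr2 {d1 d2 : ℕ} (C : Matrix (Fin d1 × Fin d2) (Fin d1 × Fin d2) ℂ) :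
    Matrix (Fin d1) (Fin d1) ℂ :=
  Matrix.of fun i j => ∑ a : Fin d2, C (i, a) (j, a)

/-- The direct sum `tr₁ C ⊕ tr₂ C`. -/
def trSum {d1 d2 : ℕ} (C : Matrix (Fin d1 × Fin d2) (Fin d1 × Fin d2) ℂ) :
    Matrix (Fin d2 ⊕ Fin d1) (Fin d2 ⊕ Fin d1) ℂ :=
  Matrix.fromBlocks (tr1 C) 0 0 (tr2 C)

/-- The diagonal matrix `Σ` of the decreasingly ordered singular values of `C`; the basis of
`ℂ^d1 ⊗ ℂ^d2` is ordered lexicographically, so (from `0`) the pair `(i, a)` has number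
`i * d2 + a`. -/
noncomputable def singDiag {d1 d2 : ℕ} (C : Matrix (Fin d1 × Fin d2) (Fin d1 × Fin d2) ℂ) :
    Matrix (Fin d1 × Fin d2) (Fin d1 × Fin d2) ℂ :=
  Matrix.diagonal fun p => ((singSeq C (p.1 * d2 + p.2) : ℝ) : ℂ)

/-- `S = ∑ i, W i ⊗ P i + ∑ j, Q j ⊗ W' j`, where `P i` and `Q j` are the projections on the
`i`-th and `j`-th standard basis vectors of `ℂ^d2` and `ℂ^d1`. -/
noncomputable def sOp {d1 d2 k1 k2 : ℕ} (hk1 : k1 ≤ d2) (hk2 : k2 ≤ d1)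
    (W : Fin k1 → Matrix.unitaryGroup (Fin d1) ℂ) (W' : Fin k2 → Matrix.unitaryGroup (Fin d2) ℂ) :
    Matrix (Fin d1 × Fin d2) (Fin d1 × Fin d2) ℂ :=
  ∑ i : Fin k1, (W i : Matrix (Fin d1) (Fin d1) ℂ) ⊗ₖ
      Matrix.single (Fin.castLE hk1 i) (Fin.castLE hk1 i) (1 : ℂ)
    + ∑ j : Fin k2, Matrix.single (Fin.castLE hk2 j) (Fin.castLE hk2 j) (1 : ℂ) ⊗ₖ
      (W' j : Matrix (Fin d2) (Fin d2) ℂ)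

/-- The vector `(2, …, 2, 1, …, 1, 0, …, 0)` of length `d1 * d2` with `k1 * k2` entries `2`,
followed by `k1 * d1 + k2 * d2 - 2 * k1 * k2` entries `1`. -/
def vVec (d1 d2 k1 k2 : ℕ) : Fin (Fintype.card (Fin d1 × Fin d2)) → ℝ :=
  fun i => if (i : ℕ) < k1 * k2 then 2
    else if (i : ℕ) + k1 * k2 < k1 * d1 + k2 * d2 then 1 else 0

end PartialTraceSVD

/-! By Ky Fan, the sum of the `k` largest singular values of `A` is the maximum of `∑ re ⟪u l, A (v
l)⟫` over orthonormal `k`-families, so every claim bounds such sums.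

For (A), `S` is a sum of two families of rank-one operators, with vectors in `H₁ ⊗ span ξ` and in
`span η ⊗ H₂`. These subspaces interact only through the `k1 * k2` vectors `η ⊗ ξ`. Hence `m` terms
contribute at most `2m`, at most `m + k1 k2`, and at most the number `k1 d1 + k2 d2` of rank-one
operators (`sum_re_crossForm_le`). The minimum of the three is the `m`-th partial sum of the target
vector `v`.

For (B) and (C), the `k` largest singular values of `tr₁ C ⊕ tr₂ C` consist of some `k1` from `tr₁
C` and `k2` from `tr₂ C`. Expanding `C` in its singular vectors writes their sum as `∑ σ n * g n`,
with `g` built from the same form as in (A), so Abel summation gives the bound `∑ σ n * v n`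
(`exists_sum_singSeq_trSum_le`). On the other side, the partial traces of `Σ` are diagonal, with the
column and row sums of the grid of the `σ n` as entries, so any `a` columns and `b` rows with `a + b
= k` give a lower bound `∑ σ n * w n` (`sum_mul_wSeq_le`).

It remains to choose `a, b` with `∑ σ n * (w n - v n) ≥ 0`. Since `σ` is constant away from at most
three extreme positions, only the partial sums over those positions matter, and these are compared
through `mul_le_of_add_le`. -/

namespace PartialTraceSVD

open Module
open scoped Kronecker

/-! ### Singular value decomposition and Ky Fan's bound -/

section KyFan

variable {E : Type*} [NormedAddCommGroup E] [InnerProductSpace ℂ E]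

/-- Singular value decomposition of an endomorphism. -/
theorem exists_svd [FiniteDimensional ℂ E] {n : ℕ} (hn : finrank ℂ E = n) (T : E →ₗ[ℂ] E) :
    ∃ u v : OrthonormalBasis (Fin n) ℂ E,
      ∀ i, T (v i) = ((T.singularValues i : ℝ) : ℂ) • u i := by
  have hS := T.isSymmetric_adjoint_comp_self
  set v := hS.eigenvectorBasis hn with hv
  have key : ∀ i j, inner ℂ (T (v i)) (T (v j)) =
      ((T.singularValues j : ℝ) : ℂ) ^ 2 * inner ℂ (v i) (v j) := by
    intro i j
    have h := hS.apply_eigenvectorBasis hn j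
    rw [← LinearMap.adjoint_inner_right]
    have h' : (LinearMap.adjoint T) (T (v j)) = (hS.eigenvalues hn j : ℂ) • v j := h
    rw [h', inner_smul_right, ← T.sq_singularValues_fin hn j]
    push_cast
    rfl
  have horth : Pairwise fun i j => inner ℂ (T (v i)) (T (v j)) = 0 := by
    intro i j hij
    rw [key, v.orthonormal.2 hij, mul_zero]
  have hnorm : ∀ i, ‖T (v i)‖ = T.singularValues i := by
    intro i
    have h := key i i
    rw [inner_self_eq_norm_sq_to_K, inner_self_eq_norm_sq_to_K, v.orthonormal.1 i] at h
    have h2 : ‖T (v i)‖ ^ 2 = (T.singularValues i) ^ 2 := by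
      refine Complex.ofReal_injective ?_
      push_cast
      simpa using h
    exact (sq_eq_sq₀ (norm_nonneg _) (T.singularValues_nonneg i)).1 h2
  have hcard : finrank ℂ E = Fintype.card (Fin n) := by simpa using hn
  -- The images `T (v i)` are already orthogonal, so Gram–Schmidt only normalizes the nonzero ones
  -- and fills the slots of the zero ones.
  refine ⟨InnerProductSpace.gramSchmidtOrthonormalBasis hcard fun i => T (v i), v, fun i => ?_⟩
  by_cases h0 : T (v i) = 0
  · have : T.singularValues i = 0 := by rw [← hnorm, h0, norm_zero]
    rw [h0, this]; simp
  · rw [InnerProductSpace.gramSchmidtOrthonormalBasis_apply_of_orthogonal hcard horth h0,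
      smul_smul, ← hnorm i]
    have : (‖T (v i)‖ : ℂ) ≠ 0 := by simpa using h0
    simp [this]

/-- The SVD as a sum of rank-one operators. -/
theorem apply_eq_sum_of_svd {ι : Type*} [Fintype ι] {T : E →ₗ[ℂ] E} {s : ι → ℝ} {u : ι → E}
    (v : OrthonormalBasis ι ℂ E) (h : ∀ i, T (v i) = ((s i : ℝ) : ℂ) • u i) (x : E) :
    T x = ∑ i, ((s i : ℂ) * inner ℂ (v i) x) • u i := by
  conv_lhs => rw [← v.sum_repr' x]
  simp only [map_sum, map_smul, h, smul_smul]
  exact Finset.sum_congr rfl fun i _ => by rw [mul_comm]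

/-- Weights in `[0, 1]` of total mass at most `T.card` do best on `T`: the excess `s - c` is
nonnegative on `T` and nonpositive off it. -/
theorem sum_mul_le_sum_of_threshold {Γ : Type*} [Fintype Γ] [DecidableEq Γ] {s h : Γ → ℝ}
    {T : Finset Γ}
    {c : ℝ} (hc : 0 ≤ c) (hT : ∀ γ ∈ T, c ≤ s γ) (hT' : ∀ γ ∉ T, s γ ≤ c) (h0 : ∀ γ, 0 ≤ h γ)
    (h1 : ∀ γ, h γ ≤ 1) (hsum : ∑ γ, h γ ≤ T.card) : ∑ γ, s γ * h γ ≤ ∑ γ ∈ T, s γ := by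
  have e : ∀ γ, s γ * h γ ≤ c * h γ + if γ ∈ T then s γ - c else 0 := by
    intro γ
    split_ifs with hγ
    · nlinarith [hT γ hγ, h1 γ]
    · nlinarith [hT' γ hγ, h0 γ]
  calc ∑ γ, s γ * h γ ≤ ∑ γ, (c * h γ + if γ ∈ T then s γ - c else 0) :=
        Finset.sum_le_sum fun γ _ => e γ
    _ = c * ∑ γ, h γ + (∑ γ ∈ T, s γ - T.card * c) := by
        rw [Finset.sum_add_distrib, ← Finset.mul_sum, Finset.sum_ite_mem, Finset.univ_inter,
          Finset.sum_sub_distrib, Finset.sum_const, nsmul_eq_mul]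
    _ ≤ _ := by nlinarith

theorem exists_top_finset {Γ : Type*} [Fintype Γ] [DecidableEq Γ] {s : Γ → ℝ} (hs : ∀ γ, 0 ≤ s γ)
    {k : ℕ} (hk : k ≤ Fintype.card Γ) :
    ∃ T : Finset Γ, T.card = k ∧ ∃ c : ℝ, 0 ≤ c ∧ (∀ γ ∈ T, c ≤ s γ) ∧ ∀ γ ∉ T, s γ ≤ c := by
  obtain ⟨T, hT, hmax⟩ := Finset.exists_max_image (Finset.powersetCard k (Finset.univ : Finset Γ))
    (fun T => ∑ γ ∈ T, s γ) (Finset.powersetCard_nonempty.2 (by simpa using hk))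
  rw [Finset.mem_powersetCard] at hT
  refine ⟨T, hT.2, ?_⟩
  rcases T.eq_empty_or_nonempty with rfl | hne
  · exact ⟨∑ γ, s γ, Finset.sum_nonneg fun γ _ => hs γ, by simp, fun γ _ =>
      Finset.single_le_sum (fun γ _ => hs γ) (Finset.mem_univ γ)⟩
  · obtain ⟨t, ht, hmin⟩ := Finset.exists_min_image T s hne
    refine ⟨s t, hs t, hmin, fun γ hγ => ?_⟩
    have hγ' : γ ∉ T.erase t := fun h => hγ (Finset.mem_of_mem_erase h)
    have h := hmax (insert γ (T.erase t)) (by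
      rw [Finset.mem_powersetCard]
      refine ⟨Finset.subset_univ _, ?_⟩
      rw [Finset.card_insert_of_notMem hγ', Finset.card_erase_of_mem ht, ← hT.2]
      have := Finset.card_pos.2 hne
      omega)
    rw [Finset.sum_insert hγ', ← Finset.add_sum_erase T s ht] at h
    linarith

theorem re_mul_le (z w : ℂ) : (z * w).re ≤ (‖z‖ ^ 2 + ‖w‖ ^ 2) / 2 := by
  have := Complex.re_le_norm (z * w)
  rw [norm_mul] at this
  nlinarith [sq_nonneg (‖z‖ - ‖w‖)]

theorem sum_norm_inner_sq_le {ι : Type*} [Fintype ι] {v : ι → E} (hv : Orthonormal ℂ v) (x : E) :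
    ∑ i, ‖inner ℂ (v i) x‖ ^ 2 ≤ ‖x‖ ^ 2 := hv.sum_inner_products_le x

theorem sum_norm_inner_sq_le' {ι : Type*} [Fintype ι] {v : ι → E} (hv : Orthonormal ℂ v) (x : E) :
    ∑ i, ‖inner ℂ x (v i)‖ ^ 2 ≤ ‖x‖ ^ 2 := by
  simpa only [norm_inner_symm] using sum_norm_inner_sq_le hv x

/-- Ky Fan: an upper bound for `∑ re ⟪a l, M b l⟫` by the sum of the largest coefficients in a
singular value decomposition of `M`. -/
theorem sum_re_inner_le_sum_top {Γ κ : Type*} [Fintype Γ] [DecidableEq Γ] [Fintype κ]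
    {M : E → E} {s : Γ → ℝ} {u v : Γ → E} (hs : ∀ γ, 0 ≤ s γ)
    (hu : Orthonormal ℂ u) (hv : Orthonormal ℂ v)
    (hM : ∀ x, M x = ∑ γ, ((s γ : ℂ) * inner ℂ (v γ) x) • u γ)
    {a b : κ → E} (ha : Orthonormal ℂ a) (hb : Orthonormal ℂ b) {T : Finset Γ} {c : ℝ}
    (hcard : T.card = Fintype.card κ) (hc : 0 ≤ c) (hT : ∀ γ ∈ T, c ≤ s γ)
    (hT' : ∀ γ ∉ T, s γ ≤ c) :
    ∑ l, (inner ℂ (a l) (M (b l))).re ≤ ∑ γ ∈ T, s γ := by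
  -- The AM–GM weights of the singular directions; Bessel over `l` gives `h ≤ 1`, and Bessel over
  -- `γ` bounds their total by the number of test vectors.
  set h : Γ → ℝ := fun γ =>
    (∑ l, (‖inner ℂ (v γ) (b l)‖ ^ 2 + ‖inner ℂ (a l) (u γ)‖ ^ 2)) / 2 with hh
  have e : ∑ l, (inner ℂ (a l) (M (b l))).re ≤ ∑ γ, s γ * h γ := by
    simp only [hM, inner_sum, inner_smul_right, Complex.re_sum]
    rw [Finset.sum_comm]
    refine Finset.sum_le_sum fun γ _ => ?_
    rw [hh, ← mul_div_assoc, Finset.mul_sum, Finset.sum_div]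
    refine Finset.sum_le_sum fun l _ => ?_
    rw [mul_assoc, Complex.re_ofReal_mul, mul_div_assoc]
    exact mul_le_mul_of_nonneg_left (re_mul_le _ _) (hs γ)
  refine e.trans (sum_mul_le_sum_of_threshold hc hT hT' (fun γ => by positivity) (fun γ => ?_) ?_)
  · have h1 := sum_norm_inner_sq_le' hb (v γ)
    have h2 := sum_norm_inner_sq_le ha (u γ)
    rw [hv.1] at h1
    rw [hu.1] at h2
    simp only [hh, Finset.sum_add_distrib]
    linarith
  · simp only [hh]
    rw [← Finset.sum_div, Finset.sum_comm, hcard]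
    have : ∀ l, ∑ γ, (‖inner ℂ (v γ) (b l)‖ ^ 2 + ‖inner ℂ (a l) (u γ)‖ ^ 2) ≤ 2 := by
      intro l
      have h1 := sum_norm_inner_sq_le hv (b l)
      have h2 := sum_norm_inner_sq_le' hu (a l)
      rw [hb.1] at h1
      rw [ha.1] at h2
      rw [Finset.sum_add_distrib]
      linarith
    have := Finset.sum_le_sum fun l (_ : l ∈ Finset.univ) => this l
    rw [Finset.sum_const, Finset.card_univ, nsmul_eq_mul] at this
    linarith

end KyFan

/-! ### Two orthonormal families with a low-rank cross Gram matrix -/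

section Core

variable {K : Type*} [NormedAddCommGroup K] [InnerProductSpace ℂ K]

/-- Nonzero eigenvalues of `Z Z*` and `Z* Z` agree, in the form of a bound on partial traces. -/
theorem sum_norm_inner_sq_le_of_gram {Γ ι : Type*} [Fintype Γ] [Fintype ι] (z : Γ → K) {w : ι → K}
    (hw : Orthonormal ℂ w) {t : ℝ}
    (ht : ∀ (r : ℕ) (f : Fin r → EuclideanSpace ℂ Γ), r ≤ Fintype.card ι → Orthonormal ℂ f →
      ∑ j, ‖∑ γ, f j γ • z γ‖ ^ 2 ≤ t) :
    ∑ i, ∑ γ, ‖inner ℂ (z γ) (w i)‖ ^ 2 ≤ t := by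
  set τ : ι → EuclideanSpace ℂ Γ := fun i => WithLp.toLp 2 fun γ => inner ℂ (z γ) (w i) with hτ
  set V := Submodule.span ℂ (Set.range τ) with hV
  -- The vectors `τ i` span at most `card ι` dimensions, so an orthonormal basis of their span is an
  -- admissible family `f` in `ht`.
  have hrank : finrank ℂ V ≤ Fintype.card ι := finrank_range_le_card τ
  set g := stdOrthonormalBasis ℂ V with hg
  have hf : Orthonormal ℂ fun j => (g j : EuclideanSpace ℂ Γ) :=
    g.orthonormal.comp_linearIsometry V.subtypeₗᵢ
  have h1 : ∀ i, ∑ γ, ‖inner ℂ (z γ) (w i)‖ ^ 2 =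
      ∑ j, ‖inner ℂ (∑ γ, (g j : EuclideanSpace ℂ Γ) γ • z γ) (w i)‖ ^ 2 := by
    intro i
    have h := g.sum_sq_norm_inner_right ⟨τ i, Submodule.subset_span ⟨i, rfl⟩⟩
    have h2 : ‖τ i‖ ^ 2 = ∑ γ, ‖inner ℂ (z γ) (w i)‖ ^ 2 := by
      rw [EuclideanSpace.norm_sq_eq]
    rw [← h2]
    refine Eq.trans h.symm (Finset.sum_congr rfl fun j _ => ?_)
    congr 2
    rw [Submodule.coe_inner, PiLp.inner_apply, sum_inner]
    refine Finset.sum_congr rfl fun γ _ => ?_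
    rw [inner_smul_left]
    simp [hτ, mul_comm]
  rw [Finset.sum_congr rfl fun i _ => h1 i, Finset.sum_comm]
  exact (Finset.sum_le_sum fun j _ => sum_norm_inner_sq_le' hw _).trans (ht _ _ hrank hf)

theorem norm_sum_smul_sq {I : Type*} [Fintype I] {z : I → K} (hz : Orthonormal ℂ z) (f : I → ℂ) :
    ‖∑ i, f i • z i‖ ^ 2 = ∑ i, ‖f i‖ ^ 2 := by
  have h := hz.inner_sum f f Finset.univ
  rw [inner_self_eq_norm_sq_to_K] at h
  refine Complex.ofReal_injective ?_
  push_cast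
  refine h.trans (Finset.sum_congr rfl fun i _ => ?_)
  rw [mul_comm, Complex.mul_conj, Complex.normSq_eq_norm_sq, Complex.ofReal_pow]

theorem re_conj_mul_le (a b : ℂ) : (starRingEnd ℂ a * b).re ≤ ‖a + b‖ ^ 2 / 4 := by
  rw [← Complex.normSq_eq_norm_sq, Complex.normSq_apply]
  simp
  nlinarith [sq_nonneg (a.re - b.re), sq_nonneg (a.im - b.im)]

/-- The Gram matrix of `x` and `y` together is the identity plus an off-diagonal part with one term
for each `e`. On a unit vector `f` its form is at most `1 + ∑ e, |⟪F e, f⟫|² / 4` with `‖F e‖² ≤ 2`,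
so Bessel charges at most `1/2` to each `e`. -/
theorem sum_norm_inner_sq_le_card_add {I J ι ε : Type*} [Fintype I] [Fintype J] [Fintype ι]
    [Fintype ε] {x : I → K} {y : J → K} (hx : Orthonormal ℂ x) (hy : Orthonormal ℂ y) {w : ι → K}
    (hw : Orthonormal ℂ w) {φ : ε → I → ℂ} {ψ : ε → J → ℂ} (hφ : ∀ e, ∑ i, ‖φ e i‖ ^ 2 ≤ 1)
    (hψ : ∀ e, ∑ j, ‖ψ e j‖ ^ 2 ≤ 1)
    (hxy : ∀ i j, inner ℂ (x i) (y j) = (∑ e, starRingEnd ℂ (φ e i) * ψ e j) / 2) :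
    ∑ l, (∑ i, ‖inner ℂ (x i) (w l)‖ ^ 2 + ∑ j, ‖inner ℂ (y j) (w l)‖ ^ 2) ≤
      Fintype.card ι + (Fintype.card ε : ℝ) / 2 := by
  have key := sum_norm_inner_sq_le_of_gram (Sum.elim x y) hw
    (t := Fintype.card ι + (Fintype.card ε : ℝ) / 2) ?_
  · simpa [Fintype.sum_sum_type] using key
  intro r f hr hf
  set F : ε → EuclideanSpace ℂ (I ⊕ J) := fun e =>
    WithLp.toLp 2 (Sum.elim (fun i => starRingEnd ℂ (φ e i)) (fun j => starRingEnd ℂ (ψ e j)))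
    with hF
  have hFn : ∀ e, ‖F e‖ ^ 2 ≤ 2 := by
    intro e
    rw [EuclideanSpace.norm_sq_eq, Fintype.sum_sum_type]
    simp only [hF, Sum.elim_inl, Sum.elim_inr, RCLike.norm_conj]
    linarith [hφ e, hψ e]
  have h1 : ∀ j, ‖∑ γ, f j γ • Sum.elim x y γ‖ ^ 2 ≤
      1 + ∑ e, ‖inner ℂ (F e) (f j)‖ ^ 2 / 4 := by
    intro j
    have hn : ∑ γ, ‖f j γ‖ ^ 2 = 1 := by
      rw [← EuclideanSpace.norm_sq_eq, hf.1]; norm_num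
    rw [Fintype.sum_sum_type] at hn ⊢
    simp only [Sum.elim_inl, Sum.elim_inr]
    rw [norm_add_sq (𝕜 := ℂ), norm_sum_smul_sq hx, norm_sum_smul_sq hy]
    have hre : 2 * (inner ℂ (∑ i, f j (Sum.inl i) • x i) (∑ k, f j (Sum.inr k) • y k)).re ≤
        ∑ e, ‖inner ℂ (F e) (f j)‖ ^ 2 / 4 := by
      have : inner ℂ (∑ i, f j (Sum.inl i) • x i) (∑ k, f j (Sum.inr k) • y k) =
          (∑ e, starRingEnd ℂ (∑ i, φ e i * f j (Sum.inl i)) *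
            (∑ k, ψ e k * f j (Sum.inr k))) / 2 := by
        simp only [sum_inner, inner_sum, inner_smul_left, inner_smul_right, hxy, map_sum, map_mul,
          Finset.sum_mul_sum]
        simp only [Finset.sum_div, Finset.mul_sum]
        rw [Finset.sum_congr rfl fun i _ => Finset.sum_comm, Finset.sum_comm]
        refine Finset.sum_congr rfl fun e _ => ?_
        rw [Finset.sum_comm]
        refine Finset.sum_congr rfl fun i _ => Finset.sum_congr rfl fun k _ => ?_
        ring
      rw [this]
      have h2 : ∀ z : ℂ, 2 * (z / 2).re = z.re := fun z => by
        rw [← Complex.re_ofReal_mul]; congr 1; push_cast; ring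
      rw [h2, Complex.re_sum]
      refine Finset.sum_le_sum fun e _ => (re_conj_mul_le _ _).trans (le_of_eq ?_)
      congr 3
      rw [PiLp.inner_apply, Fintype.sum_sum_type]
      simp [hF, mul_comm]
    have hre' : RCLike.re (inner ℂ (∑ i, f j (Sum.inl i) • x i) (∑ k, f j (Sum.inr k) • y k)) =
      (inner ℂ (∑ i, f j (Sum.inl i) • x i) (∑ k, f j (Sum.inr k) • y k)).re := rfl
    rw [hre']
    linarith
  refine (Finset.sum_le_sum fun j _ => h1 j).trans ?_
  rw [Finset.sum_add_distrib, Finset.sum_comm]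
  have h2 : ∀ e, ∑ j, ‖inner ℂ (F e) (f j)‖ ^ 2 / 4 ≤ 1 / 2 := by
    intro e
    rw [← Finset.sum_div]
    linarith [sum_norm_inner_sq_le' hf (F e), hFn e]
  have h3 := Finset.sum_le_sum fun e (_ : e ∈ Finset.univ) => h2 e
  simp only [Finset.sum_const, Finset.card_univ, nsmul_eq_mul, Fintype.card_fin] at h3 ⊢
  have : (r : ℝ) ≤ Fintype.card ι := by exact_mod_cast hr
  linarith

end Core

/-! ### Passing to `E ⊕ E` to treat left and right vectors at once -/

section Doubling

variable {E : Type*} [NormedAddCommGroup E] [InnerProductSpace ℂ E]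

/-- The vector `(x, y) / √2` of `E ⊕ E`. -/
noncomputable def dbl (x y : E) : WithLp 2 (E × E) :=
  (((√2)⁻¹ : ℝ) : ℂ) • WithLp.toLp 2 (x, y)

theorem inner_dbl (x y x' y' : E) :
    inner ℂ (dbl x y) (dbl x' y') = (inner ℂ x x' + inner ℂ y y') / 2 := by
  have h : (((√2)⁻¹ : ℝ) : ℂ) * (((√2)⁻¹ : ℝ) : ℂ) = 1 / 2 := by
    rw [← Complex.ofReal_mul, ← mul_inv, Real.mul_self_sqrt (by norm_num)]
    norm_num
  rw [dbl, dbl, inner_smul_left, inner_smul_right, ← mul_assoc, Complex.conj_ofReal, h,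
    WithLp.prod_inner_apply]
  ring

theorem orthonormal_dbl {I : Type*} {x y : I → E} (hx : Orthonormal ℂ x) (hy : Orthonormal ℂ y) :
    Orthonormal ℂ fun i => dbl (x i) (y i) := by
  classical
  rw [orthonormal_iff_ite] at *
  intro i j
  rw [inner_dbl, hx, hy]
  split_ifs <;> norm_num

/-- The sesquilinear form of the operator `∑ i, |a' i⟩⟨a i|`. -/
noncomputable def rankOneSum {I : Type*} [Fintype I] (a' a : I → E) (x y : E) : ℂ :=
  ∑ i, inner ℂ x (a' i) * inner ℂ (a i) y

/-- AM–GM in the form `re (conj a * b) ≤ |a + b|² / 4`; it replaces a two-sided pairing by a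
positive quadratic form in the doubled vectors. -/
theorem re_rankOneSum_le {I : Type*} [Fintype I] (a' a : I → E) (x y : E) :
    (rankOneSum a' a x y).re ≤ ∑ i, ‖inner ℂ (dbl (a' i) (a i)) (dbl x y)‖ ^ 2 := by
  rw [rankOneSum, Complex.re_sum]
  refine Finset.sum_le_sum fun i _ => ?_
  have h := re_conj_mul_le (inner ℂ (a' i) x) (inner ℂ (a i) y)
  rw [inner_conj_symm] at h
  rw [inner_dbl, norm_div, div_pow]
  rwa [Complex.norm_ofNat, show (2 : ℝ) ^ 2 = 4 by norm_num]

variable {I J ι ε : Type*} [Fintype I] [Fintype J] [Fintype ι] [Fintype ε]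
  {a' a : I → E} {b' b : J → E} {u v : ι → E}

theorem sum_re_rankOneSum_le_two_mul (ha' : Orthonormal ℂ a') (ha : Orthonormal ℂ a)
    (hb' : Orthonormal ℂ b') (hb : Orthonormal ℂ b) (hu : Orthonormal ℂ u) (hv : Orthonormal ℂ v) :
    ∑ l, (rankOneSum a' a (u l) (v l) + rankOneSum b' b (u l) (v l)).re ≤
      2 * (Fintype.card ι : ℝ) := by
  have h : ∀ l, (rankOneSum a' a (u l) (v l) + rankOneSum b' b (u l) (v l)).re ≤ 2 := by
    intro l
    have hw : ‖dbl (u l) (v l)‖ = 1 := (orthonormal_dbl hu hv).1 l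
    have h1 := sum_norm_inner_sq_le (orthonormal_dbl ha' ha) (dbl (u l) (v l))
    have h2 := sum_norm_inner_sq_le (orthonormal_dbl hb' hb) (dbl (u l) (v l))
    rw [hw] at h1 h2
    rw [Complex.add_re]
    linarith [re_rankOneSum_le a' a (u l) (v l), re_rankOneSum_le b' b (u l) (v l)]
  refine (Finset.sum_le_sum fun l _ => h l).trans (le_of_eq ?_)
  rw [Finset.sum_const, nsmul_eq_mul, Finset.card_univ, mul_comm]

theorem sum_re_rankOneSum_le_card (ha' : Orthonormal ℂ a') (ha : Orthonormal ℂ a)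
    (hu : Orthonormal ℂ u) (hv : Orthonormal ℂ v) :
    ∑ l, (rankOneSum a' a (u l) (v l)).re ≤ (Fintype.card I : ℝ) := by
  refine (Finset.sum_le_sum fun l _ => re_rankOneSum_le a' a (u l) (v l)).trans ?_
  rw [Finset.sum_comm]
  have h : ∀ i, ∑ l, ‖inner ℂ (dbl (a' i) (a i)) (dbl (u l) (v l))‖ ^ 2 ≤ 1 := by
    intro i
    have h1 := sum_norm_inner_sq_le' (orthonormal_dbl hu hv) (dbl (a' i) (a i))
    have h2 : ‖dbl (a' i) (a i)‖ = 1 := (orthonormal_dbl ha' ha).1 i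
    simpa [h2] using h1
  refine (Finset.sum_le_sum fun i _ => h i).trans (le_of_eq ?_)
  simp

theorem sum_re_rankOneSum_le_card_add (ha' : Orthonormal ℂ a') (ha : Orthonormal ℂ a)
    (hb' : Orthonormal ℂ b') (hb : Orthonormal ℂ b) (hu : Orthonormal ℂ u) (hv : Orthonormal ℂ v)
    {e' e : ε → E} (he' : ∀ k, ‖e' k‖ = 1) (he : ∀ k, ‖e k‖ = 1)
    (hab' : ∀ i j, inner ℂ (a' i) (b' j) = ∑ k, inner ℂ (a' i) (e' k) * inner ℂ (e' k) (b' j))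
    (hab : ∀ i j, inner ℂ (a i) (b j) = ∑ k, inner ℂ (a i) (e k) * inner ℂ (e k) (b j)) :
    ∑ l, (rankOneSum a' a (u l) (v l) + rankOneSum b' b (u l) (v l)).re ≤
      Fintype.card ι + (Fintype.card ε : ℝ) := by
  have key := sum_norm_inner_sq_le_card_add (orthonormal_dbl ha' ha) (orthonormal_dbl hb' hb)
    (orthonormal_dbl hu hv)
    (φ := Sum.elim (fun k i => inner ℂ (e' k) (a' i)) (fun k i => inner ℂ (e k) (a i)))
    (ψ := Sum.elim (fun k j => inner ℂ (e' k) (b' j)) (fun k j => inner ℂ (e k) (b j)))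
    ?_ ?_ ?_
  · have hc : (Fintype.card (ε ⊕ ε) : ℝ) / 2 = Fintype.card ε := by
      rw [Fintype.card_sum]; push_cast; ring
    rw [hc] at key
    refine (Finset.sum_le_sum fun l _ => ?_).trans key
    rw [Complex.add_re]
    exact add_le_add (re_rankOneSum_le _ _ _ _) (re_rankOneSum_le _ _ _ _)
  · rintro (k | k)
    · simpa [he'] using sum_norm_inner_sq_le' ha' (e' k)
    · simpa [he] using sum_norm_inner_sq_le' ha (e k)
  · rintro (k | k)
    · simpa [he'] using sum_norm_inner_sq_le' hb' (e' k)
    · simpa [he] using sum_norm_inner_sq_le' hb (e k)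
  · intro i j
    rw [inner_dbl, hab', hab, Fintype.sum_sum_type]
    simp only [Sum.elim_inl, Sum.elim_inr, inner_conj_symm]

end Doubling

/-! ### Tensor families and the three bounds on the cross form -/

section Tensor

variable {d1 d2 : ℕ}

/-- The elementary tensor `x ⊗ y`. -/
noncomputable def tens (x : EuclideanSpace ℂ (Fin d1)) (y : EuclideanSpace ℂ (Fin d2)) :
    EuclideanSpace ℂ (Fin d1 × Fin d2) :=
  WithLp.toLp 2 fun p => x p.1 * y p.2

theorem inner_tens (x x' : EuclideanSpace ℂ (Fin d1)) (y y' : EuclideanSpace ℂ (Fin d2)) :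
    inner ℂ (tens x y) (tens x' y') = inner ℂ x x' * inner ℂ y y' := by
  simp only [PiLp.inner_apply, Finset.sum_mul_sum, Fintype.sum_prod_type]
  refine Finset.sum_congr rfl fun i _ => Finset.sum_congr rfl fun a _ => ?_
  simp [tens]
  ring

variable {κ1 κ2 : Type*}

theorem orthonormal_tens_left {α : κ1 → Fin d1 → EuclideanSpace ℂ (Fin d1)}
    {ξ : κ1 → EuclideanSpace ℂ (Fin d2)} (hα : ∀ k, Orthonormal ℂ (α k)) (hξ : Orthonormal ℂ ξ) :
    Orthonormal ℂ fun p : κ1 × Fin d1 => tens (α p.1 p.2) (ξ p.1) := by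
  classical
  rw [orthonormal_iff_ite] at *
  rintro ⟨k, l⟩ ⟨k', l'⟩
  simp only [inner_tens, hξ]
  by_cases h : k = k'
  · subst h
    have := orthonormal_iff_ite.1 (hα k) l l'
    simp [this]
  · simp [h]

theorem orthonormal_tens_right {η : κ2 → EuclideanSpace ℂ (Fin d1)}
    {β : κ2 → Fin d2 → EuclideanSpace ℂ (Fin d2)} (hη : Orthonormal ℂ η)
    (hβ : ∀ k, Orthonormal ℂ (β k)) :
    Orthonormal ℂ fun p : κ2 × Fin d2 => tens (η p.1) (β p.1 p.2) := by
  classical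
  rw [orthonormal_iff_ite] at *
  rintro ⟨k, l⟩ ⟨k', l'⟩
  simp only [inner_tens, hη]
  by_cases h : k = k'
  · subst h
    have := orthonormal_iff_ite.1 (hβ k) l l'
    simp [this]
  · simp [h]

theorem norm_tens (x : EuclideanSpace ℂ (Fin d1)) (y : EuclideanSpace ℂ (Fin d2))
    (hx : ‖x‖ = 1) (hy : ‖y‖ = 1) : ‖tens x y‖ = 1 := by
  have h := inner_tens x x y y
  rw [inner_self_eq_norm_sq_to_K, inner_self_eq_norm_sq_to_K, inner_self_eq_norm_sq_to_K,
    hx, hy] at h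
  have h2 : ‖tens x y‖ ^ 2 = 1 := by
    refine Complex.ofReal_injective ?_
    push_cast
    simpa using h
  exact (pow_eq_one_iff_of_nonneg (norm_nonneg _) two_ne_zero).1 h2

variable [Fintype κ1] [Fintype κ2]

/-- Orthonormality leaves only the term with `ξ p.1` and `η q.1`. So the two families see each other
only through the `k1 * k2` vectors `η ⊗ ξ`, the source of the term `k1 k2` below. -/
theorem inner_tens_eq_sum {α : κ1 → Fin d1 → EuclideanSpace ℂ (Fin d1)}
    {ξ : κ1 → EuclideanSpace ℂ (Fin d2)} (hξ : Orthonormal ℂ ξ)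
    {η : κ2 → EuclideanSpace ℂ (Fin d1)} {β : κ2 → Fin d2 → EuclideanSpace ℂ (Fin d2)}
    (hη : Orthonormal ℂ η) (p : κ1 × Fin d1) (q : κ2 × Fin d2) :
    inner ℂ (tens (α p.1 p.2) (ξ p.1)) (tens (η q.1) (β q.1 q.2)) =
      ∑ k : κ1 × κ2, inner ℂ (tens (α p.1 p.2) (ξ p.1)) (tens (η k.2) (ξ k.1)) *
        inner ℂ (tens (η k.2) (ξ k.1)) (tens (η q.1) (β q.1 q.2)) := by
  classical
  rw [orthonormal_iff_ite] at *
  simp [inner_tens, hξ, hη, Fintype.sum_prod_type]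

variable {ι : Type*} [Fintype ι] {u v : ι → EuclideanSpace ℂ (Fin d1 × Fin d2)}
  {α' α : κ1 → Fin d1 → EuclideanSpace ℂ (Fin d1)} {ξ' ξ : κ1 → EuclideanSpace ℂ (Fin d2)}
  {η' η : κ2 → EuclideanSpace ℂ (Fin d1)} {β' β : κ2 → Fin d2 → EuclideanSpace ℂ (Fin d2)}

/-- The form of `∑ k l, |α' k l ⊗ ξ' k⟩⟨α k l ⊗ ξ k| + ∑ k l, |η' k ⊗ β' k l⟩⟨η k ⊗ β k l|`. -/
noncomputable def crossForm (α' α : κ1 → Fin d1 → EuclideanSpace ℂ (Fin d1))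
    (ξ' ξ : κ1 → EuclideanSpace ℂ (Fin d2)) (η' η : κ2 → EuclideanSpace ℂ (Fin d1))
    (β' β : κ2 → Fin d2 → EuclideanSpace ℂ (Fin d2))
    (x y : EuclideanSpace ℂ (Fin d1 × Fin d2)) : ℂ :=
  rankOneSum (fun p : κ1 × Fin d1 => tens (α' p.1 p.2) (ξ' p.1))
      (fun p : κ1 × Fin d1 => tens (α p.1 p.2) (ξ p.1)) x y +
    rankOneSum (fun p : κ2 × Fin d2 => tens (η' p.1) (β' p.1 p.2))
      (fun p : κ2 × Fin d2 => tens (η p.1) (β p.1 p.2)) x y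

theorem sum_re_crossForm_le (hα' : ∀ k, Orthonormal ℂ (α' k)) (hα : ∀ k, Orthonormal ℂ (α k))
    (hξ' : Orthonormal ℂ ξ') (hξ : Orthonormal ℂ ξ) (hη' : Orthonormal ℂ η')
    (hη : Orthonormal ℂ η) (hβ' : ∀ k, Orthonormal ℂ (β' k)) (hβ : ∀ k, Orthonormal ℂ (β k))
    (hu : Orthonormal ℂ u) (hv : Orthonormal ℂ v) :
    ∑ l, (crossForm α' α ξ' ξ η' η β' β (u l) (v l)).re ≤
      min (2 * (Fintype.card ι : ℝ)) (min (Fintype.card ι + Fintype.card κ1 * Fintype.card κ2)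
        (Fintype.card κ1 * d1 + Fintype.card κ2 * d2)) := by
  have ha' := orthonormal_tens_left hα' hξ'
  have ha := orthonormal_tens_left hα hξ
  have hb' := orthonormal_tens_right hη' hβ'
  have hb := orthonormal_tens_right hη hβ
  refine le_min (sum_re_rankOneSum_le_two_mul ha' ha hb' hb hu hv) (le_min ?_ ?_)
  · refine (sum_re_rankOneSum_le_card_add (ε := κ1 × κ2) ha' ha hb' hb hu hv
      (e' := fun k => tens (η' k.2) (ξ' k.1)) (e := fun k => tens (η k.2) (ξ k.1))
      (fun k => norm_tens _ _ (hη'.1 _) (hξ'.1 _)) (fun k => norm_tens _ _ (hη.1 _) (hξ.1 _))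
      (inner_tens_eq_sum hξ' hη') (inner_tens_eq_sum hξ hη)).trans (le_of_eq ?_)
    simp
  · have h1 := sum_re_rankOneSum_le_card ha' ha hu hv
    have h2 := sum_re_rankOneSum_le_card hb' hb hu hv
    simp only [crossForm, Complex.add_re, Finset.sum_add_distrib]
    simp only [Fintype.card_prod, Fintype.card_fin, Nat.cast_mul] at h1 h2
    linarith

end Tensor

/-! ### Weak majorization through partial sums of singular values -/

section Reduction

theorem decr_eq_self {n : ℕ} {x : Fin n → ℝ} (hx : Antitone x) : decr x = x := by
  have h : Monotone fun i => OrderDual.toDual (x i) := fun i j hij => hx hij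
  rw [decr, Tuple.sort_eq_refl_iff_monotone.2 h]
  rfl

theorem sum_filter_lt_eq_sum_range {n k : ℕ} (hk : k ≤ n) (f : ℕ → ℝ) :
    ∑ i ∈ Finset.univ.filter (fun i : Fin n => (i : ℕ) < k), f i = ∑ i ∈ Finset.range k, f i := by
  rw [Finset.sum_filter, Fin.sum_univ_eq_sum_range (fun i => if i < k then f i else 0) n,
    ← Finset.sum_filter]
  congr 1
  ext i
  simp
  omega

theorem weakMaj_of_antitone {n : ℕ} {f g : ℕ → ℝ} (hf : Antitone f) (hg : Antitone g)
    (h : ∀ k, k ≤ n → ∑ i ∈ Finset.range k, f i ≤ ∑ i ∈ Finset.range k, g i) :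
    WeakMaj (fun i : Fin n => f i) (fun i : Fin n => g i) := by
  intro k _ hk
  rw [decr_eq_self (x := fun i : Fin n => f i) fun i j hij => hf hij,
    decr_eq_self (x := fun i : Fin n => g i) fun i j hij => hg hij,
    sum_filter_lt_eq_sum_range hk f, sum_filter_lt_eq_sum_range hk g]
  exact h k hk

variable {ι : Type*} [Fintype ι] [DecidableEq ι] (A : Matrix ι ι ℂ)

theorem singSeq_antitone : Antitone (singSeq A) := LinearMap.singularValues_antitone _

theorem singSeq_nonneg (i : ℕ) : 0 ≤ singSeq A i := LinearMap.singularValues_nonneg _ i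

theorem singSeq_eq_zero_of_rank_le {i : ℕ} (h : A.rank ≤ i) : singSeq A i = 0 := by
  rw [singSeq, LinearMap.singularValues_eq_zero_iff_le_finrank_range]
  rwa [Matrix.rank_eq_finrank_range_toLin A (EuclideanSpace.basisFun ι ℂ).toBasis
    (EuclideanSpace.basisFun ι ℂ).toBasis] at h

theorem exists_singSeq_svd : ∃ u v : OrthonormalBasis (Fin (Fintype.card ι)) ℂ (EuclideanSpace ℂ ι),
    ∀ i, Matrix.toEuclideanLin A (v i) = ((singSeq A i : ℝ) : ℂ) • u i :=
  exists_svd finrank_euclideanSpace _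

theorem exists_sum_range_singSeq_eq {k : ℕ} (hk : k ≤ Fintype.card ι) :
    ∃ u v : Fin k → EuclideanSpace ℂ ι, Orthonormal ℂ u ∧ Orthonormal ℂ v ∧
      ∑ i ∈ Finset.range k, singSeq A i =
        ∑ l, (inner ℂ (u l) (Matrix.toEuclideanLin A (v l))).re := by
  obtain ⟨u, v, h⟩ := exists_singSeq_svd A
  refine ⟨u ∘ Fin.castLE hk, v ∘ Fin.castLE hk,
    u.orthonormal.comp _ (Fin.castLE_injective hk), v.orthonormal.comp _ (Fin.castLE_injective hk), ?_⟩
  rw [← Fin.sum_univ_eq_sum_range]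
  refine Finset.sum_congr rfl fun l _ => ?_
  simp only [Function.comp_apply, h, inner_smul_right]
  rw [inner_self_eq_norm_sq_to_K, u.orthonormal.1]
  simp

/-- Ky Fan's inequality. -/
theorem sum_re_inner_le_sum_singSeq {k : ℕ} {κ : Type*} [Fintype κ] (hκ : Fintype.card κ = k)
    {a b : κ → EuclideanSpace ℂ ι} (ha : Orthonormal ℂ a) (hb : Orthonormal ℂ b) :
    ∑ l, (inner ℂ (a l) (Matrix.toEuclideanLin A (b l))).re ≤ ∑ i ∈ Finset.range k, singSeq A i := by
  obtain ⟨u, v, h⟩ := exists_singSeq_svd A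
  have hk : k ≤ Fintype.card ι := by
    have := ha.linearIndependent.fintype_card_le_finrank
    rwa [finrank_euclideanSpace, hκ] at this
  refine (sum_re_inner_le_sum_top (c := singSeq A k)
    (s := fun i : Fin (Fintype.card ι) => singSeq A i)
    (T := Finset.univ.filter fun i : Fin (Fintype.card ι) => (i : ℕ) < k)
    (fun i => singSeq_nonneg A i) u.orthonormal v.orthonormal
    (apply_eq_sum_of_svd v h) ha hb ?_ (singSeq_nonneg A k) ?_ ?_).trans
    (le_of_eq (sum_filter_lt_eq_sum_range hk (singSeq A)))
  · rw [hκ]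
    have := sum_filter_lt_eq_sum_range hk fun _ => (1 : ℝ)
    simp only [Finset.sum_const, nsmul_eq_mul, mul_one, Finset.card_range] at this
    exact_mod_cast this
  · intro i hi
    exact singSeq_antitone A (Finset.mem_filter.1 hi).2.le
  · intro i hi
    exact singSeq_antitone A (by simpa using hi)

end Reduction

/-! ### The comparison vector and part (A) -/

/-- The sequence `2, …, 2, 1, …, 1, 0, …` underlying `vVec`. -/
def vSeq (d1 d2 k1 k2 : ℕ) : ℕ → ℝ :=
  fun i => if i < k1 * k2 then 2 else if i + k1 * k2 < k1 * d1 + k2 * d2 then 1 else 0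

theorem vSeq_antitone (d1 d2 k1 k2 : ℕ) : Antitone (vSeq d1 d2 k1 k2) := by
  intro i j hij
  unfold vSeq
  split_ifs <;> first | omega | norm_num

theorem sum_range_ite_lt (m p : ℕ) :
    ∑ i ∈ Finset.range m, (if i < p then (1 : ℝ) else 0) = min (m : ℝ) p := by
  rw [← Finset.sum_filter, Finset.sum_const, nsmul_one]
  have : (Finset.range m).filter (· < p) = Finset.range (min m p) := by ext i; simp
  rw [this, Finset.card_range, Nat.cast_min]

theorem two_mul_mul_le {d1 d2 k1 k2 : ℕ} (hk1 : k1 ≤ d2) (hk2 : k2 ≤ d1) :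
    2 * (k1 * k2) ≤ k1 * d1 + k2 * d2 := by nlinarith

theorem sum_range_vSeq {d1 d2 k1 k2 : ℕ} (hk1 : k1 ≤ d2) (hk2 : k2 ≤ d1) (m : ℕ) :
    ∑ i ∈ Finset.range m, vSeq d1 d2 k1 k2 i =
      min (2 * (m : ℝ)) (min (m + k1 * k2) (k1 * d1 + k2 * d2)) := by
  have h := two_mul_mul_le hk1 hk2
  obtain ⟨r, hr⟩ := Nat.exists_eq_add_of_le h
  -- A sum of two initial-segment indicators, `r` being the number of ones; its partial sums are two
  -- truncations of `m`.
  have e : ∀ i, vSeq d1 d2 k1 k2 i =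
      (if i < k1 * k2 then 1 else 0) + if i < k1 * k2 + r then 1 else 0 := by
    intro i
    unfold vSeq
    split_ifs <;> first | omega | norm_num
  rw [Finset.sum_congr rfl fun i _ => e i, Finset.sum_add_distrib, sum_range_ite_lt,
    sum_range_ite_lt]
  have hr' : (k1 * d1 + k2 * d2 : ℝ) = 2 * (k1 * k2) + r := by exact_mod_cast hr
  have h0 : (0 : ℝ) ≤ r := Nat.cast_nonneg r
  have h1 : (0 : ℝ) ≤ k1 * k2 := by positivity
  rw [hr']
  push_cast
  rcases min_cases (m : ℝ) (k1 * k2) with h2 | h2 <;>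
  rcases min_cases (m : ℝ) (k1 * k2 + r) with h3 | h3 <;>
  rcases min_cases (m + k1 * k2 : ℝ) (2 * (k1 * k2) + r) with h4 | h4 <;>
  rcases min_cases (2 * (m : ℝ)) (min (m + k1 * k2 : ℝ) (2 * (k1 * k2) + r)) with h5 | h5 <;>
  linarith

section PartA

variable {d1 d2 k1 k2 : ℕ}

theorem orthonormal_col {d : ℕ} (W : Matrix.unitaryGroup (Fin d) ℂ) :
    Orthonormal ℂ fun l : Fin d =>
      (WithLp.toLp 2 fun i => (W : Matrix (Fin d) (Fin d) ℂ) i l : EuclideanSpace ℂ (Fin d)) := by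
  rw [orthonormal_iff_ite]
  intro i j
  have h := congrFun (congrFun (Matrix.UnitaryGroup.star_mul_self W) i) j
  rw [Matrix.mul_apply, Matrix.one_apply] at h
  rw [← h, PiLp.inner_apply]
  refine Finset.sum_congr rfl fun k _ => ?_
  simp [Matrix.star_apply, mul_comm]

theorem inner_toEuclideanLin {ι : Type*} [Fintype ι] [DecidableEq ι] (A : Matrix ι ι ℂ)
    (x y : EuclideanSpace ℂ ι) :
    inner ℂ x (Matrix.toEuclideanLin A y) = ∑ p, ∑ q, starRingEnd ℂ (x p) * (A p q * y q) := by
  rw [PiLp.inner_apply]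
  refine Finset.sum_congr rfl fun p _ => ?_
  rw [Matrix.ofLp_toLpLin, Matrix.toLin'_apply, Matrix.mulVec, dotProduct, ← Finset.mul_sum]
  simp [mul_comm]

theorem inner_tens_single_left (l : Fin d1) (c : Fin d2)
    (y : EuclideanSpace ℂ (Fin d1 × Fin d2)) :
    inner ℂ (tens (EuclideanSpace.single l 1) (EuclideanSpace.single c 1)) y = y (l, c) := by
  have : tens (EuclideanSpace.single l 1) (EuclideanSpace.single c 1) =
      EuclideanSpace.single (l, c) (1 : ℂ) := by
    ext p
    by_cases h : p.1 = l <;> simp [tens, Prod.ext_iff, h]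
  rw [this, EuclideanSpace.inner_single_left, map_one, one_mul]

theorem inner_kronecker_single (W : Matrix (Fin d1) (Fin d1) ℂ) (c : Fin d2)
    (x y : EuclideanSpace ℂ (Fin d1 × Fin d2)) :
    inner ℂ x (Matrix.toEuclideanLin (W ⊗ₖ Matrix.single c c 1) y) =
      ∑ l, inner ℂ x (tens (WithLp.toLp 2 fun i => W i l) (EuclideanSpace.single c 1)) *
        inner ℂ (tens (EuclideanSpace.single l 1) (EuclideanSpace.single c 1)) y := by
  simp only [inner_tens_single_left]
  rw [inner_toEuclideanLin]
  simp only [PiLp.inner_apply, Finset.sum_mul, Fintype.sum_prod_type, tens,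
    Matrix.kroneckerMap_apply, Matrix.single_apply]
  simp [ite_and]
  rw [Finset.sum_comm]
  exact Finset.sum_congr rfl fun _ _ => Finset.sum_congr rfl fun _ _ => by ring

theorem inner_single_kronecker (W : Matrix (Fin d2) (Fin d2) ℂ) (c : Fin d1)
    (x y : EuclideanSpace ℂ (Fin d1 × Fin d2)) :
    inner ℂ x (Matrix.toEuclideanLin (Matrix.single c c (1 : ℂ) ⊗ₖ W) y) =
      ∑ l, inner ℂ x (tens (EuclideanSpace.single c 1) (WithLp.toLp 2 fun i => W i l)) *
        inner ℂ (tens (EuclideanSpace.single c 1) (EuclideanSpace.single l 1)) y := by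
  simp only [inner_tens_single_left]
  rw [inner_toEuclideanLin]
  simp only [PiLp.inner_apply, Finset.sum_mul, Fintype.sum_prod_type, tens,
    Matrix.kroneckerMap_apply, Matrix.single_apply]
  simp [ite_and]
  rw [Finset.sum_comm]
  exact Finset.sum_congr rfl fun _ _ => Finset.sum_congr rfl fun _ _ => by ring

theorem inner_sOp (hk1 : k1 ≤ d2) (hk2 : k2 ≤ d1) (W : Fin k1 → Matrix.unitaryGroup (Fin d1) ℂ)
    (W' : Fin k2 → Matrix.unitaryGroup (Fin d2) ℂ) (x y : EuclideanSpace ℂ (Fin d1 × Fin d2)) :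
    inner ℂ x (Matrix.toEuclideanLin (sOp hk1 hk2 W W') y) =
      crossForm (fun k l => WithLp.toLp 2 fun i => (W k : Matrix (Fin d1) (Fin d1) ℂ) i l)
        (fun _ l => EuclideanSpace.single l 1)
        (fun k => EuclideanSpace.single (Fin.castLE hk1 k) 1)
        (fun k => EuclideanSpace.single (Fin.castLE hk1 k) 1)
        (fun k => EuclideanSpace.single (Fin.castLE hk2 k) 1)
        (fun k => EuclideanSpace.single (Fin.castLE hk2 k) 1)
        (fun k l => WithLp.toLp 2 fun i => (W' k : Matrix (Fin d2) (Fin d2) ℂ) i l)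
        (fun _ l => EuclideanSpace.single l 1) x y := by
  simp only [sOp, map_add, map_sum, LinearMap.add_apply, LinearMap.sum_apply, inner_add_right,
    inner_sum, inner_kronecker_single, inner_single_kronecker, crossForm, rankOneSum,
    Fintype.sum_prod_type]

theorem weakMaj_sOp (hk1 : k1 ≤ d2) (hk2 : k2 ≤ d1)
    (W : Fin k1 → Matrix.unitaryGroup (Fin d1) ℂ) (W' : Fin k2 → Matrix.unitaryGroup (Fin d2) ℂ) :
    WeakMaj (sing (sOp hk1 hk2 W W')) (vVec d1 d2 k1 k2) := by
  refine weakMaj_of_antitone (g := vSeq d1 d2 k1 k2) (singSeq_antitone _)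
    (vSeq_antitone d1 d2 k1 k2) fun m hm => ?_
  obtain ⟨u, v, hu, hv, h⟩ := exists_sum_range_singSeq_eq (sOp hk1 hk2 W W') hm
  rw [h, sum_range_vSeq hk1 hk2]
  simp only [inner_sOp]
  have hs : ∀ d : ℕ, Orthonormal ℂ fun l : Fin d => EuclideanSpace.single l (1 : ℂ) :=
    fun d => EuclideanSpace.orthonormal_single
  refine (sum_re_crossForm_le (fun k => orthonormal_col (W k)) (fun _ => hs _)
    ((hs d2).comp _ (Fin.castLE_injective hk1)) ((hs d2).comp _ (Fin.castLE_injective hk1))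
    ((hs d1).comp _ (Fin.castLE_injective hk2)) ((hs d1).comp _ (Fin.castLE_injective hk2))
    (fun k => orthonormal_col (W' k)) (fun _ => hs _) hu hv).trans (le_of_eq ?_)
  simp

end PartA

/-! ### Decompositions of direct sums, and Abel summation -/

section Blocks

variable {m n : Type*} [Fintype m] [Fintype n]

theorem inner_toLp_elim (x x' : EuclideanSpace ℂ m) (y y' : EuclideanSpace ℂ n) :
    inner ℂ (WithLp.toLp 2 (Sum.elim x y) : EuclideanSpace ℂ (m ⊕ n))
      (WithLp.toLp 2 (Sum.elim x' y')) = inner ℂ x x' + inner ℂ y y' := by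
  simp [PiLp.inner_apply, Fintype.sum_sum_type]

/-- The family `(x i, 0), (0, y j)` of `ℂ^m ⊕ ℂ^n`. -/
noncomputable def sumFamily {ι κ : Type*} (x : ι → EuclideanSpace ℂ m) (y : κ → EuclideanSpace ℂ n) :
    ι ⊕ κ → EuclideanSpace ℂ (m ⊕ n) :=
  Sum.elim (fun i => WithLp.toLp 2 (Sum.elim (x i) (0 : EuclideanSpace ℂ n)))
    (fun j => WithLp.toLp 2 (Sum.elim (0 : EuclideanSpace ℂ m) (y j)))

theorem orthonormal_sumFamily {ι κ : Type*} {x : ι → EuclideanSpace ℂ m}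
    {y : κ → EuclideanSpace ℂ n} (hx : Orthonormal ℂ x) (hy : Orthonormal ℂ y) :
    Orthonormal ℂ (sumFamily x y) := by
  classical
  rw [orthonormal_iff_ite] at *
  rintro (i | i) (j | j)
  all_goals
    simp only [sumFamily, Sum.elim_inl, Sum.elim_inr, inner_toLp_elim]
    simp [hx, hy]

theorem fromBlocks_apply_eq_sum [DecidableEq m] [DecidableEq n] {ι κ : Type*} [Fintype ι] [Fintype κ] {A : Matrix m m ℂ}
    {B : Matrix n n ℂ} {s : ι → ℝ} {t : κ → ℝ} {u v : ι → EuclideanSpace ℂ m}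
    {u' v' : κ → EuclideanSpace ℂ n}
    (hA : ∀ x, Matrix.toEuclideanLin A x = ∑ i, ((s i : ℂ) * inner ℂ (v i) x) • u i)
    (hB : ∀ x, Matrix.toEuclideanLin B x = ∑ i, ((t i : ℂ) * inner ℂ (v' i) x) • u' i)
    (x : EuclideanSpace ℂ (m ⊕ n)) :
    Matrix.toEuclideanLin (Matrix.fromBlocks A 0 0 B) x =
      ∑ γ, (((Sum.elim s t γ : ℝ) : ℂ) * inner ℂ (sumFamily v v' γ) x) • sumFamily u u' γ := by
  obtain ⟨y, z, rfl⟩ : ∃ (y : EuclideanSpace ℂ m) (z : EuclideanSpace ℂ n),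
      x = WithLp.toLp 2 (Sum.elim y z) :=
    ⟨WithLp.toLp 2 fun i => x (Sum.inl i), WithLp.toLp 2 fun i => x (Sum.inr i), by
      ext (i | i) <;> rfl⟩
  have h1 := fun i => congrArg (fun w : EuclideanSpace ℂ m => w i) (hA y)
  have h2 := fun i => congrArg (fun w : EuclideanSpace ℂ n => w i) (hB z)
  simp only [Matrix.ofLp_toLpLin, Matrix.toLin'_apply] at h1 h2
  ext (i | i)
  all_goals
    simp only [sumFamily, Fintype.sum_sum_type, Sum.elim_inl, Sum.elim_inr, inner_toLp_elim]
    simp [Matrix.fromBlocks_mulVec, h1, h2]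

end Blocks

/-- Abel summation: the induction keeps the weighted gap above `σ m` times the unweighted gap, which
survives as `σ` decreases. -/
theorem sum_mul_le_sum_mul_of_antitone {σ g w : ℕ → ℝ} (hσ : Antitone σ) (h0 : ∀ n, 0 ≤ σ n)
    {N : ℕ} (h : ∀ m ≤ N, ∑ n ∈ Finset.range m, g n ≤ ∑ n ∈ Finset.range m, w n) :
    ∑ n ∈ Finset.range N, σ n * g n ≤ ∑ n ∈ Finset.range N, σ n * w n := by
  have key : ∀ m ≤ N, σ m * (∑ n ∈ Finset.range m, w n - ∑ n ∈ Finset.range m, g n) ≤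
      ∑ n ∈ Finset.range m, σ n * w n - ∑ n ∈ Finset.range m, σ n * g n := by
    intro m
    induction m with
    | zero => simp
    | succ m ih =>
      intro hm
      have h1 := ih (by omega)
      have h2 := h (m + 1) hm
      simp only [Finset.sum_range_succ] at h2 ⊢
      nlinarith [hσ (Nat.le_succ m)]
  have := key N le_rfl
  nlinarith [h N le_rfl, h0 N]

/-! ### Partial traces against sums over the grid of singular values -/

variable {d1 d2 : ℕ} (C : Matrix (Fin d1 × Fin d2) (Fin d1 × Fin d2) ℂ)

theorem inner_tr1 (x y : EuclideanSpace ℂ (Fin d2)) :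
    inner ℂ x (Matrix.toEuclideanLin (tr1 C) y) =
      ∑ l, inner ℂ (tens (EuclideanSpace.single l 1) x)
        (Matrix.toEuclideanLin C (tens (EuclideanSpace.single l 1) y)) := by
  simp only [inner_toEuclideanLin]
  simp only [tens, tr1, Fintype.sum_prod_type, Matrix.of_apply, Finset.sum_mul, Finset.mul_sum]
  simp only [PiLp.single_apply, ite_mul, one_mul, zero_mul, mul_ite, mul_zero,
    apply_ite (starRingEnd ℂ), map_zero, Finset.sum_ite_eq', Finset.mem_univ,
    Finset.sum_const_zero, if_true, Finset.sum_ite_irrel]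
  rw [Finset.sum_congr rfl fun a _ => Finset.sum_comm, Finset.sum_comm]

theorem inner_tr2 (x y : EuclideanSpace ℂ (Fin d1)) :
    inner ℂ x (Matrix.toEuclideanLin (tr2 C) y) =
      ∑ l, inner ℂ (tens x (EuclideanSpace.single l 1))
        (Matrix.toEuclideanLin C (tens y (EuclideanSpace.single l 1))) := by
  simp only [inner_toEuclideanLin]
  simp only [tens, tr2, Fintype.sum_prod_type, Matrix.of_apply, Finset.sum_mul, Finset.mul_sum]
  simp only [PiLp.single_apply, ite_mul, zero_mul, mul_ite, mul_one, mul_zero,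
    apply_ite (starRingEnd ℂ), map_zero, Finset.sum_ite_eq', Finset.mem_univ,
    Finset.sum_const_zero, if_true, Finset.sum_ite_irrel]
  rw [Finset.sum_congr rfl fun a _ => Finset.sum_comm, Finset.sum_comm]

theorem sum_range_mul_eq (f : ℕ → ℝ) :
    ∑ n ∈ Finset.range (d1 * d2), f n = ∑ i : Fin d1, ∑ a : Fin d2, f (i * d2 + a) := by
  rw [← Fin.sum_univ_eq_sum_range, ← finProdFinEquiv.sum_comp, Fintype.sum_prod_type]
  refine Finset.sum_congr rfl fun i _ => Finset.sum_congr rfl fun a _ => ?_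
  rw [finProdFinEquiv_apply_val, add_comm, mul_comm]

/-- The multiplicity with which the cell number `n` of the `d1 × d2` grid is covered by the first
`k1` columns and the first `k2` rows. -/
def wSeq (d2 k1 k2 : ℕ) : ℕ → ℝ :=
  fun n => (if n % d2 < k1 then 1 else 0) + if n / d2 < k2 then 1 else 0

theorem sum_castLE_eq {n k : ℕ} (hk : k ≤ n) (f : Fin n → ℝ) :
    ∑ i : Fin k, f (Fin.castLE hk i) = ∑ i : Fin n, if (i : ℕ) < k then f i else 0 := by
  rw [← Finset.sum_filter]
  refine Finset.sum_bij (fun i _ => Fin.castLE hk i) (by simp)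
    (fun i _ j _ h => Fin.castLE_injective hk h) (fun j hj => ?_) (fun _ _ => rfl)
  exact ⟨⟨j, by simpa using hj⟩, by simp, rfl⟩

theorem sum_mul_wSeq {k1 k2 : ℕ} (hk1 : k1 ≤ d2) (hk2 : k2 ≤ d1) (σ : ℕ → ℝ) :
    ∑ n ∈ Finset.range (d1 * d2), σ n * wSeq d2 k1 k2 n =
      ∑ a : Fin k1, ∑ i : Fin d1, σ (i * d2 + a) + ∑ i : Fin k2, ∑ a : Fin d2, σ (i * d2 + a) := by
  have h1 := sum_castLE_eq hk1 fun a : Fin d2 => ∑ i : Fin d1, σ (i * d2 + a)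
  have h2 := sum_castLE_eq hk2 fun i : Fin d1 => ∑ a : Fin d2, σ (i * d2 + a)
  simp only [Fin.val_castLE] at h1 h2
  rw [h1, h2, sum_range_mul_eq]
  simp only [wSeq, mul_add, Finset.sum_add_distrib]
  congr 1
  · rw [Finset.sum_comm]
    refine Finset.sum_congr rfl fun a _ => ?_
    split_ifs with h <;> simp [Nat.mod_eq_of_lt, h]
  · refine Finset.sum_congr rfl fun i _ => ?_
    have : ∀ a : Fin d2, (i * d2 + a : ℕ) / d2 = i := fun a => by
      rw [mul_comm, Nat.mul_add_div (Nat.zero_lt_of_lt a.2), Nat.div_eq_of_lt a.2, add_zero]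
    split_ifs with h <;> simp [this, h]

theorem sum_range_wSeq {k1 k2 : ℕ} (hk1 : k1 ≤ d2) (hk2 : k2 ≤ d1) :
    ∑ n ∈ Finset.range (d1 * d2), wSeq d2 k1 k2 n = k1 * d1 + k2 * d2 := by
  simpa using sum_mul_wSeq hk1 hk2 fun _ => 1

theorem inner_single_toEuclideanLin_single {ι : Type*} [Fintype ι] [DecidableEq ι]
    (A : Matrix ι ι ℂ) (i : ι) :
    inner ℂ (EuclideanSpace.single i (1 : ℂ))
      (Matrix.toEuclideanLin A (EuclideanSpace.single i 1)) = A i i := by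
  simp [EuclideanSpace.inner_single_left]

/-- Ky Fan tested on `k1` and `k2` standard basis vectors of the two blocks reads off diagonal
entries, which are column and row sums of the grid. -/
theorem sum_mul_wSeq_le {k k1 k2 : ℕ} (hk : k1 + k2 = k) (hk1 : k1 ≤ d2) (hk2 : k2 ≤ d1) :
    ∑ n ∈ Finset.range (d1 * d2), singSeq C n * wSeq d2 k1 k2 n ≤
      ∑ i ∈ Finset.range k, singSeq (trSum (singDiag C)) i := by
  have ho : Orthonormal ℂ fun γ : Fin k1 ⊕ Fin k2 =>
      EuclideanSpace.single (Sum.map (Fin.castLE hk1) (Fin.castLE hk2) γ) (1 : ℂ) :=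
    EuclideanSpace.orthonormal_single.comp _
      (Function.Injective.sumMap (Fin.castLE_injective hk1) (Fin.castLE_injective hk2))
  have key := sum_re_inner_le_sum_singSeq (trSum (singDiag C))
    (κ := Fin k1 ⊕ Fin k2) (k := k) (by simp [hk]) ho ho
  refine le_trans (le_of_eq ?_) key
  rw [sum_mul_wSeq hk1 hk2, Fintype.sum_sum_type]
  simp only [inner_single_toEuclideanLin_single]
  simp [trSum, tr1, tr2, singDiag]

theorem exists_sum_singSeq_trSum_le {k : ℕ} (hk : k ≤ d2 + d1) :
    ∃ k1 k2, k1 ≤ d2 ∧ k2 ≤ d1 ∧ k1 + k2 = k ∧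
      ∑ i ∈ Finset.range k, singSeq (trSum C) i ≤
        ∑ n ∈ Finset.range (d1 * d2), singSeq C n * vSeq d1 d2 k1 k2 n := by
  obtain ⟨u1, v1, h1⟩ := exists_singSeq_svd (tr1 C)
  obtain ⟨u2, v2, h2⟩ := exists_singSeq_svd (tr2 C)
  obtain ⟨U, V, hC⟩ := exists_singSeq_svd C
  set s : Fin (Fintype.card (Fin d2)) ⊕ Fin (Fintype.card (Fin d1)) → ℝ :=
    Sum.elim (fun i => singSeq (tr1 C) i) (fun i => singSeq (tr2 C) i) with hs
  have hs0 : ∀ γ, 0 ≤ s γ := by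
    rintro (i | i)
    · exact singSeq_nonneg _ _
    · exact singSeq_nonneg _ _
  -- `T` selects `k` largest singular values of the two blocks; its left and right parts give `k1`
  -- and `k2`.
  obtain ⟨T, hTk, c, hc, hT, hT'⟩ := exists_top_finset hs0 (k := k) (by simpa using hk)
  obtain ⟨a, b, ha, hb, hab⟩ := exists_sum_range_singSeq_eq (trSum C) (k := k) (by simpa using hk)
  have hle : ∑ i ∈ Finset.range k, singSeq (trSum C) i ≤ ∑ γ ∈ T, s γ := by
    rw [hab]
    exact sum_re_inner_le_sum_top hs0 (orthonormal_sumFamily u1.orthonormal u2.orthonormal)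
      (orthonormal_sumFamily v1.orthonormal v2.orthonormal)
      (fun x => by
        rw [trSum, fromBlocks_apply_eq_sum
          (apply_eq_sum_of_svd (s := fun i : Fin _ => singSeq (tr1 C) i) v1 h1)
          (apply_eq_sum_of_svd (s := fun i : Fin _ => singSeq (tr2 C) i) v2 h2)])
      ha hb (by simpa using hTk) hc hT hT'
  have hcard := T.card_toLeft_add_card_toRight
  have hl : T.toLeft.card ≤ d2 := by simpa using Finset.card_le_univ T.toLeft
  have hr : T.toRight.card ≤ d1 := by simpa using Finset.card_le_univ T.toRight
  refine ⟨T.toLeft.card, T.toRight.card, hl, hr, by rw [hcard, hTk], hle.trans ?_⟩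
  set e1 : Fin d1 → EuclideanSpace ℂ (Fin d1) := fun l => EuclideanSpace.single l 1 with he1
  set e2 : Fin d2 → EuclideanSpace ℂ (Fin d2) := fun l => EuclideanSpace.single l 1 with he2
  have ho1 : Orthonormal ℂ e1 := EuclideanSpace.orthonormal_single
  have ho2 : Orthonormal ℂ e2 := EuclideanSpace.orthonormal_single
  set F := crossForm (fun _ => e1) (fun _ => e1) (fun i : T.toLeft => u1 i)
    (fun i : T.toLeft => v1 i) (fun i : T.toRight => u2 i) (fun i : T.toRight => v2 i)
    (fun _ => e2) (fun _ => e2) with hF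
  -- The coefficient of the `n`-th singular value of `C`; the value `0` past the size is never used.
  set g : ℕ → ℝ := fun n => if h : n < Fintype.card (Fin d1 × Fin d2) then
    (F (U ⟨n, h⟩) (V ⟨n, h⟩)).re else 0 with hg
  have hN : Fintype.card (Fin d1 × Fin d2) = d1 * d2 := by simp
  have hg' : ∀ i : Fin (Fintype.card (Fin d1 × Fin d2)), g i = (F (U i) (V i)).re := by
    intro i
    exact dif_pos i.2
  have hCx : ∀ x y, (inner ℂ x (Matrix.toEuclideanLin C y)).re =
      ∑ n : Fin (Fintype.card (Fin d1 × Fin d2)), singSeq C n * (inner ℂ (U n) x * inner ℂ y (V n)).re := by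
    intro x y
    rw [apply_eq_sum_of_svd (s := fun i : Fin _ => singSeq C i) V hC, inner_sum, Complex.re_sum]
    refine Finset.sum_congr rfl fun n _ => ?_
    rw [inner_smul_right, mul_assoc, Complex.re_ofReal_mul, ← Complex.conj_re, map_mul,
      inner_conj_symm, inner_conj_symm, mul_comm (inner ℂ y _)]
  have hsum : ∑ γ ∈ T, s γ = ∑ n ∈ Finset.range (d1 * d2), singSeq C n * g n := by
    have hsv1 : ∀ i : Fin (Fintype.card (Fin d2)), singSeq (tr1 C) i = (inner ℂ (u1 i) (Matrix.toEuclideanLin (tr1 C) (v1 i))).re := by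
      intro i
      rw [h1, inner_smul_right, inner_self_eq_norm_sq_to_K, u1.orthonormal.1]
      simp
    have hsv2 : ∀ i : Fin (Fintype.card (Fin d1)), singSeq (tr2 C) i = (inner ℂ (u2 i) (Matrix.toEuclideanLin (tr2 C) (v2 i))).re := by
      intro i
      rw [h2, inner_smul_right, inner_self_eq_norm_sq_to_K, u2.orthonormal.1]
      simp
    rw [← hN, ← Fin.sum_univ_eq_sum_range (fun n => singSeq C n * g n)]
    simp only [hg', hF, crossForm, rankOneSum, Complex.add_re, Complex.re_sum, mul_add,
      Finset.mul_sum, Finset.sum_add_distrib]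
    rw [Finset.sum_comm, Finset.sum_comm (s := Finset.univ (α := Fin _))]
    have hsplit : ∑ γ ∈ T, s γ =
        ∑ i ∈ T.toLeft, s (Sum.inl i) + ∑ i ∈ T.toRight, s (Sum.inr i) := by
      conv_lhs => rw [← T.toLeft_disjSum_toRight, Finset.sum_disjSum]
    rw [hsplit]
    simp only [hs, Sum.elim_inl, Sum.elim_inr, hsv1, hsv2, inner_tr1, inner_tr2, Complex.re_sum,
      hCx, Fintype.sum_prod_type]
    congr 1
    · rw [← Finset.sum_coe_sort]
    · rw [← Finset.sum_coe_sort]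
  rw [hsum]
  -- Partial sums of `g` are values of the cross form on orthonormal families, so the bounds behind
  -- (A) apply to them.
  refine sum_mul_le_sum_mul_of_antitone (singSeq_antitone C) (singSeq_nonneg C) fun m hm => ?_
  rw [sum_range_vSeq hl hr, ← Fin.sum_univ_eq_sum_range]
  have hm' : m ≤ Fintype.card (Fin d1 × Fin d2) := hN ▸ hm
  have key := sum_re_crossForm_le (fun _ : T.toLeft => ho1) (fun _ : T.toLeft => ho1)
    (u1.orthonormal.comp _ Subtype.val_injective) (v1.orthonormal.comp _ Subtype.val_injective)
    (u2.orthonormal.comp _ (Subtype.val_injective (p := (· ∈ T.toRight))))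
    (v2.orthonormal.comp _ Subtype.val_injective)
    (fun _ : T.toRight => ho2) (fun _ : T.toRight => ho2)
    (U.orthonormal.comp _ (Fin.castLE_injective hm')) (V.orthonormal.comp _ (Fin.castLE_injective hm'))
  refine le_trans (le_of_eq (Finset.sum_congr rfl fun i _ => hg' (Fin.castLE hm' i)))
    (key.trans (le_of_eq ?_))
  simp only [Fintype.card_coe, Fintype.card_fin]

/-! ### Choosing rows and columns: comparison at the two ends -/

section Exchange

theorem sum_range_back (f : ℕ → ℝ) {N j : ℕ} (hj : j ≤ N) :
    ∑ i ∈ Finset.range j, f (N - 1 - i) =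
      ∑ n ∈ Finset.range N, f n - ∑ n ∈ Finset.range (N - j), f n := by
  obtain ⟨r, rfl⟩ := Nat.exists_eq_add_of_le' hj
  rw [Nat.add_sub_cancel, Finset.sum_range_add, add_sub_cancel_left, ← Finset.sum_range_reflect]
  refine Finset.sum_congr rfl fun i hi => congrArg f ?_
  have := Finset.mem_range.1 hi
  omega

/-- If `σ` is constant in the middle, then only the partial sums of `D` from the front and from the
back matter for the sign of `∑ σ n * D n`. -/
theorem sum_mul_nonneg_of_const_mid {σ D : ℕ → ℝ} (hσ : Antitone σ) {s : ℝ} {f M b : ℕ}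
    (hM : 0 < M) (hs : ∀ n, f ≤ n → n < f + M → σ n = s)
    (hD : s * ∑ n ∈ Finset.range (f + M + b), D n = 0)
    (hf : ∀ m ≤ f, 0 ≤ ∑ n ∈ Finset.range m, D n)
    (hb : ∀ j ≤ b, ∑ i ∈ Finset.range j, D (f + M + b - 1 - i) ≤ 0) :
    0 ≤ ∑ n ∈ Finset.range (f + M + b), σ n * D n := by
  -- Shifting by `s` kills the middle and leaves monotone weights of one sign at each end.
  have e : ∑ n ∈ Finset.range (f + M + b), σ n * D n =
      ∑ n ∈ Finset.range (f + M + b), (σ n - s) * D n := by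
    rw [← sub_zero (∑ n ∈ Finset.range (f + M + b), σ n * D n), ← hD, Finset.mul_sum,
      ← Finset.sum_sub_distrib]
    exact Finset.sum_congr rfl fun n _ => by ring
  have hfront : 0 ≤ ∑ n ∈ Finset.range f, (σ n - s) * D n := by
    have h := sum_mul_le_sum_mul_of_antitone (σ := fun n => max (σ n - s) 0) (g := fun _ => 0)
      (w := D) (N := f) (fun i j hij => max_le_max_right 0 (sub_le_sub_right (hσ hij) s))
      (fun n => le_max_right _ _) (fun m hm => by simpa using hf m hm)
    simp only [mul_zero, Finset.sum_const_zero] at h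
    refine h.trans (le_of_eq (Finset.sum_congr rfl fun n hn => ?_))
    have h1 : s ≤ σ n := by
      rw [← hs f le_rfl (by omega)]
      exact hσ (Finset.mem_range.1 hn).le
    rw [max_eq_left (sub_nonneg.2 h1)]
  have hmid : ∑ i ∈ Finset.range M, (σ (f + i) - s) * D (f + i) = 0 :=
    Finset.sum_eq_zero fun i hi => by
      rw [hs (f + i) (by omega) (by have := Finset.mem_range.1 hi; omega), sub_self, zero_mul]
  have hback : 0 ≤ ∑ i ∈ Finset.range b, (σ (f + M + b - 1 - i) - s) * D (f + M + b - 1 - i) := by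
    have h := sum_mul_le_sum_mul_of_antitone (σ := fun i => max (s - σ (f + M + b - 1 - i)) 0)
      (g := fun i => D (f + M + b - 1 - i)) (w := fun _ => 0) (N := b)
      (fun i j hij => max_le_max_right 0 (sub_le_sub_left (hσ (by omega)) s))
      (fun n => le_max_right _ _) (fun m hm => by simpa using hb m hm)
    simp only [mul_zero, Finset.sum_const_zero] at h
    rw [← neg_nonpos, ← Finset.sum_neg_distrib]
    refine le_trans (le_of_eq (Finset.sum_congr rfl fun i hi => ?_)) h
    have h1 : σ (f + M + b - 1 - i) ≤ s := by
      rw [← hs f le_rfl (by omega)]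
      have := Finset.mem_range.1 hi
      exact hσ (by omega)
    rw [max_eq_left (sub_nonneg.2 h1)]
    ring
  rw [sum_range_back (fun n => (σ n - s) * D n) (by omega), Nat.add_sub_cancel,
    Finset.sum_range_add _ f M, hmid, add_zero] at hback
  rw [e]
  linarith

theorem sum_range_vSeq_le {d1 d2 k1 k2 : ℕ} (hk1 : k1 ≤ d2) (hk2 : k2 ≤ d1) (m : ℕ) :
    ∑ i ∈ Finset.range m, vSeq d1 d2 k1 k2 i ≤ 2 * m ∧
      ∑ i ∈ Finset.range m, vSeq d1 d2 k1 k2 i ≤ m + k1 * k2 ∧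
      ∑ i ∈ Finset.range m, vSeq d1 d2 k1 k2 i ≤ k1 * d1 + k2 * d2 := by
  rw [sum_range_vSeq hk1 hk2]
  exact ⟨min_le_left _ _, (min_le_right _ _).trans (min_le_left _ _),
    (min_le_right _ _).trans (min_le_right _ _)⟩

theorem sum_range_vSeq_total {d1 d2 k1 k2 : ℕ} (hk1 : k1 ≤ d2) (hk2 : k2 ≤ d1) :
    ∑ i ∈ Finset.range (d1 * d2), vSeq d1 d2 k1 k2 i = k1 * d1 + k2 * d2 := by
  have h1 : (k1 : ℝ) ≤ d2 := by exact_mod_cast hk1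
  have h2 : (k2 : ℝ) ≤ d1 := by exact_mod_cast hk2
  have h3 : (0 : ℝ) ≤ k1 := Nat.cast_nonneg _
  have h4 : (0 : ℝ) ≤ k2 := Nat.cast_nonneg _
  rw [sum_range_vSeq hk1 hk2, min_eq_right, min_eq_right]
  · push_cast; nlinarith
  · rw [min_eq_right] <;> push_cast <;> nlinarith

/-- Total minus the front bounds; the middle one uses `d1 d2 + k1 k2 - k1 d1 - k2 d2 = (d2 - k1) (d1
- k2)`. -/
theorem le_sum_range_vSeq_back {d1 d2 k1 k2 j : ℕ} (hk1 : k1 ≤ d2) (hk2 : k2 ≤ d1)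
    (hj : j ≤ d1 * d2) :
    0 ≤ ∑ i ∈ Finset.range j, vSeq d1 d2 k1 k2 (d1 * d2 - 1 - i) ∧
      (j : ℝ) - ((d2 - k1) * (d1 - k2) : ℕ) ≤
        ∑ i ∈ Finset.range j, vSeq d1 d2 k1 k2 (d1 * d2 - 1 - i) ∧
      2 * (j : ℝ) - (((d2 - k1) * d1 : ℕ) + ((d1 - k2) * d2 : ℕ)) ≤
        ∑ i ∈ Finset.range j, vSeq d1 d2 k1 k2 (d1 * d2 - 1 - i) := by
  have h := sum_range_vSeq_le hk1 hk2 (d1 * d2 - j)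
  rw [sum_range_back _ hj, sum_range_vSeq_total hk1 hk2]
  push_cast [Nat.cast_sub hj, Nat.cast_sub hk1, Nat.cast_sub hk2] at h ⊢
  refine ⟨by linarith [h.2.2], by linarith [h.2.1], by linarith [h.1]⟩

theorem wSeq_front {d2 k1 k2 n : ℕ} (hn : n < d2) :
    wSeq d2 k1 k2 n = (if n < k1 then 1 else 0) + if 0 < k2 then 1 else 0 := by
  rw [wSeq, Nat.mod_eq_of_lt hn, Nat.div_eq_of_lt hn]

theorem wSeq_back {d1 d2 k1 k2 i : ℕ} (hi : i < d2) (hd1 : 0 < d1) :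
    wSeq d2 k1 k2 (d1 * d2 - 1 - i) =
      (if d2 - 1 - i < k1 then 1 else 0) + if d1 - 1 < k2 then 1 else 0 := by
  obtain ⟨e, rfl⟩ := Nat.exists_eq_add_of_le' hd1
  have : (e + 1) * d2 - 1 - i = d2 * e + (d2 - 1 - i) := by
    rw [add_mul, one_mul, mul_comm]; omega
  rw [wSeq, this, Nat.mul_add_mod, Nat.mod_eq_of_lt (by omega), Nat.mul_add_div (by omega),
    Nat.div_eq_of_lt (by omega), add_zero, Nat.add_sub_cancel]

/-- This bounds the number of twos in `v` at the front, or of zeros at the back. It fails at `c =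
3`, where `2 * 2 = 4`, which is why only three end positions are handled. -/
theorem mul_le_of_add_le {a b c : ℕ} (h : a + b ≤ c + 1) (hc : c ≤ 2) : a * b ≤ c := by
  have ha : a ≤ 3 := by omega
  interval_cases a <;> omega

/-- The partial sums of `w` from the front dominate those of `v`. -/
def FrontLE (v w : ℕ → ℝ) (f : ℕ) : Prop :=
  ∀ m ≤ f, ∑ n ∈ Finset.range m, v n ≤ ∑ n ∈ Finset.range m, w n

/-- The partial sums of `w` from the back, up to `N`, are dominated by those of `v`. -/
def BackLE (v w : ℕ → ℝ) (N b : ℕ) : Prop :=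
  ∀ j ≤ b, ∑ i ∈ Finset.range j, w (N - 1 - i) ≤ ∑ i ∈ Finset.range j, v (N - 1 - i)

theorem exists_frontLE_three {d1 d2 k1 k2 : ℕ} (h1 : 2 ≤ d1) (h2 : 2 ≤ d2)
    (h : d1 ≤ d2 ∨ 3 ≤ d2) (hk1 : k1 ≤ d2) (hk2 : k2 ≤ d1) :
    ∃ k1' k2', k1' ≤ d2 ∧ k2' ≤ d1 ∧ k1' + k2' = k1 + k2 ∧
      FrontLE (vSeq d1 d2 k1 k2) (wSeq d2 k1' k2') 3 := by
  by_cases hd : d2 = 2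
  · obtain rfl : d1 = 2 := by omega
    subst hd
    -- The pair depends only on the total: `(0,0)`, `(0,1)`, `(1,1)`, `(2,1)`, `(2,2)` for `0, …,
    -- 4`.
    interval_cases k1 <;> interval_cases k2 <;>
      [refine ⟨0, 0, ?_⟩; refine ⟨0, 1, ?_⟩; refine ⟨1, 1, ?_⟩; refine ⟨0, 1, ?_⟩;
        refine ⟨1, 1, ?_⟩; refine ⟨2, 1, ?_⟩; refine ⟨1, 1, ?_⟩; refine ⟨2, 1, ?_⟩;
        refine ⟨2, 2, ?_⟩] <;>
      refine ⟨by norm_num, by norm_num, by norm_num, fun m hm => ?_⟩ <;>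
      interval_cases m <;> norm_num [Finset.sum_range_succ, vSeq, wSeq] <;> decide
  have hd3 : 3 ≤ d2 := by omega
  have hw : ∀ a b, ∀ n < 3, wSeq d2 a b n = (if n < a then 1 else 0) + if 0 < b then 1 else 0 :=
    fun a b n hn => wSeq_front (by omega)
  have hV := sum_range_vSeq_le hk1 hk2
  have hc : ∀ c : ℕ, c ≤ 2 → k1 + k2 ≤ c + 1 → (k1 * k2 : ℝ) ≤ c := fun c hc h => by
    exact_mod_cast mul_le_of_add_le h hc
  rcases Nat.eq_zero_or_pos (k1 + k2) with hk | hk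
  · obtain ⟨rfl, rfl⟩ : k1 = 0 ∧ k2 = 0 := by omega
    refine ⟨0, 0, by omega, by omega, rfl, fun m hm => (hV m).2.2.trans ?_⟩
    simpa using Finset.sum_nonneg fun n _ => by simp [wSeq]
  -- The first three cells lie in the first row. Cover that row once and spend the rest on columns,
  -- until these run out.
  obtain ⟨a, b, ha, hb, hab, hab'⟩ : ∃ a b, a ≤ d2 ∧ b ≤ d1 ∧ a + b = k1 + k2 ∧ 0 < b ∧
      (k1 + k2 = a + 1 ∨ 3 ≤ a) := by
    by_cases h4 : k1 + k2 ≤ d2 + 1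
    · exact ⟨k1 + k2 - 1, 1, by omega⟩
    · exact ⟨d2, k1 + k2 - d2, by omega⟩
  refine ⟨a, b, ha, hb, hab, fun m hm => ?_⟩
  have hV2 := (hV m).2.1
  have hV1 := (hV m).1
  by_cases h3 : 3 ≤ a
  · refine hV1.trans (le_of_eq ?_)
    rw [Finset.sum_congr rfl fun n hn => hw a b n (by have := Finset.mem_range.1 hn; omega)]
    rw [Finset.sum_congr rfl fun n hn => by
      rw [if_pos (by have := Finset.mem_range.1 hn; omega), if_pos hab'.1]]
    simp
    ring
  · have hk' := hc a (by omega) (by omega)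
    rw [Finset.sum_congr rfl fun n hn => hw a b n (by have := Finset.mem_range.1 hn; omega)]
    simp only [hab'.1, if_true]
    rw [Finset.sum_add_distrib, sum_range_ite_lt]
    simp only [Finset.sum_const, Finset.card_range, nsmul_one]
    rcases min_cases (m : ℝ) a with h5 | h5 <;> linarith

end Exchange

/-! ### The square grid with exceptional positions at both ends -/

section Square

variable {d k1 k2 : ℕ}

theorem frontLE_square {a b f : ℕ} (hd : 3 ≤ d) (hf : f ≤ 2) (hk1 : k1 ≤ d) (hk2 : k2 ≤ d)
    (h : (k1 + k2 = 0) ∨ (k1 + k2 = 1 ∧ 0 < b) ∨ (k1 + k2 = 2 ∧ 0 < a ∧ 0 < b) ∨ (f ≤ a ∧ 0 < b)) :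
    FrontLE (vSeq d d k1 k2) (wSeq d a b) f := by
  intro m hm
  obtain ⟨h1, h2, h3⟩ := sum_range_vSeq_le hk1 hk2 m
  have hc : ∀ c : ℕ, c ≤ 2 → k1 + k2 ≤ c + 1 → (k1 * k2 : ℝ) ≤ c := fun c hc h => by
    exact_mod_cast mul_le_of_add_le h hc
  have hw : ∀ n < 2, wSeq d a b n = (if n < a then 1 else 0) + if 0 < b then 1 else 0 :=
    fun n hn => wSeq_front (by omega)
  rcases h with h | ⟨h, hb⟩ | ⟨h, ha, hb⟩ | ⟨ha, hb⟩
  · obtain ⟨rfl, rfl⟩ : k1 = 0 ∧ k2 = 0 := by omega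
    refine h3.trans ?_
    simpa using Finset.sum_nonneg fun n _ => by unfold wSeq; positivity
  · have := hc 0 (by omega) (by omega)
    have hm' : m ≤ 2 := by omega
    interval_cases m <;> simp only [Finset.sum_range_succ, Finset.sum_range_zero, hw 0 (by omega),
      hw 1 (by omega), hb, if_true] <;> push_cast at * <;> (try split_ifs) <;>
      simp only [Finset.sum_range_succ, Finset.sum_range_zero] at h2 <;> linarith
  · have := hc 1 (by omega) (by omega)
    have hm' : m ≤ 2 := by omega
    interval_cases m <;> simp only [Finset.sum_range_succ, Finset.sum_range_zero, hw 0 (by omega),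
      hw 1 (by omega), ha, hb, if_true] <;> push_cast at * <;> (try split_ifs) <;>
      simp only [Finset.sum_range_succ, Finset.sum_range_zero] at h1 h2 <;> linarith
  · refine h1.trans (le_of_eq ?_)
    rw [Finset.sum_congr rfl fun n hn => by
      have := Finset.mem_range.1 hn
      rw [hw n (by omega), if_pos (by omega), if_pos hb]]
    simp
    ring

/-- The mirror image of the front case, in terms of the missing `d - a` columns and `d - b` rows:
with the last row uncovered, missing columns put zeros in the last cells of `w`. -/
theorem backLE_square {a b t : ℕ} (hd : 3 ≤ d) (ht : t ≤ 3) (hk1 : k1 ≤ d) (hk2 : k2 ≤ d)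
    (h : (k1 + k2 = 2 * d) ∨ (k1 + k2 + 1 = 2 * d ∧ b < d) ∨ (k1 + k2 + 2 = 2 * d ∧ a < d ∧ b < d) ∨
      (k1 + k2 + 3 = 2 * d ∧ a + 2 ≤ d ∧ b < d) ∨ (a + t ≤ d ∧ b < d)) :
    BackLE (vSeq d d k1 k2) (wSeq d a b) (d * d) t := by
  intro j hj
  have hjd : j ≤ d * d := by nlinarith
  obtain ⟨h1, h2, h3⟩ := le_sum_range_vSeq_back hk1 hk2 hjd
  have hc : ∀ c : ℕ, c ≤ 2 → 2 * d ≤ k1 + k2 + c + 1 → (((d - k1) * (d - k2) : ℕ) : ℝ) ≤ c :=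
    fun c hc h => by exact_mod_cast mul_le_of_add_le (by omega) hc
  have hw : ∀ i < 3, wSeq d a b (d * d - 1 - i) =
      (if d - 1 - i < a then 1 else 0) + if d - 1 < b then 1 else 0 :=
    fun i hi => wSeq_back (by omega) (by omega)
  have hj3 : j ≤ 3 := by omega
  have e : ∀ c : ℕ, c ≤ 3 → b < d → a + c ≤ d →
      ∑ i ∈ Finset.range j, wSeq d a b (d * d - 1 - i) ≤ max ((j : ℝ) - c) 0 := by
    intro c hc hb ha
    rw [Finset.sum_congr rfl fun i hi => hw i (by have := Finset.mem_range.1 hi; omega),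
      if_neg (by omega)]
    have hle : ∀ i ∈ Finset.range j, (if d - 1 - i < a then (1 : ℝ) else 0) + 0 ≤
        1 - if i < c then 1 else 0 := by
      intro i hi
      have := Finset.mem_range.1 hi
      split_ifs <;> first | omega | norm_num
    refine (Finset.sum_le_sum hle).trans ?_
    rw [Finset.sum_sub_distrib, sum_range_ite_lt]
    simp only [Finset.sum_const, Finset.card_range, nsmul_one]
    rcases min_cases (j : ℝ) c with h5 | h5 <;> rcases max_cases ((j : ℝ) - c) 0 with h6 | h6 <;>
      linarith
  rcases h with h | ⟨h, hb⟩ | ⟨h, ha, hb⟩ | ⟨h, ha, hb⟩ | ⟨ha, hb⟩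
  · obtain ⟨rfl, rfl⟩ : k1 = d ∧ k2 = d := by omega
    refine le_trans ?_ h3
    refine (Finset.sum_le_card_nsmul _ _ 2 fun i _ => ?_).trans (by simp; linarith)
    unfold wSeq
    split_ifs <;> norm_num
  · have h4 := hc 0 (by omega) (by omega)
    have hle : ∑ i ∈ Finset.range j, wSeq d a b (d * d - 1 - i) ≤ j := by
      refine (Finset.sum_le_card_nsmul _ _ 1 fun i hi => ?_).trans (by simp)
      rw [hw i (by have := Finset.mem_range.1 hi; omega), if_neg (show ¬ d - 1 < b by omega)]
      split_ifs <;> norm_num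
    rw [Nat.cast_zero] at h4
    linarith
  · have h4 := hc 1 (by omega) (by omega)
    refine (e 1 (by omega) hb (by omega)).trans (max_le ?_ h1)
    linarith
  · have h4 := hc 2 (by omega) (by omega)
    refine (e 2 (by omega) hb (by omega)).trans (max_le ?_ h1)
    linarith
  · refine (e t ht hb ha).trans (max_le ?_ h1)
    have : (j : ℝ) ≤ t := by exact_mod_cast hj
    linarith

theorem exists_frontLE_backLE_square {f t : ℕ} (hd : 3 ≤ d) (hft : f + t = 3) (ht : 1 ≤ t)
    (hk1 : k1 ≤ d) (hk2 : k2 ≤ d) :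
    ∃ a b, a ≤ d ∧ b ≤ d ∧ a + b = k1 + k2 ∧ FrontLE (vSeq d d k1 k2) (wSeq d a b) f ∧
      BackLE (vSeq d d k1 k2) (wSeq d a b) (d * d) t := by
  suffices h : ∃ a b, a ≤ d ∧ b ≤ d ∧ a + b = k1 + k2 ∧
      ((k1 + k2 = 0) ∨ (k1 + k2 = 1 ∧ 0 < b) ∨ (k1 + k2 = 2 ∧ 0 < a ∧ 0 < b) ∨ (f ≤ a ∧ 0 < b) ∨
        f = 0) ∧
      ((k1 + k2 = 2 * d) ∨ (k1 + k2 + 1 = 2 * d ∧ b < d) ∨ (k1 + k2 + 2 = 2 * d ∧ a < d ∧ b < d) ∨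
        (k1 + k2 + 3 = 2 * d ∧ a + 2 ≤ d ∧ b < d) ∨ (a + t ≤ d ∧ b < d)) by
    -- Both ends now reduce to inequalities on `a` and `b`; the witnesses below leave some row and
    -- column free unless the total is within one of `2 * d`.
    obtain ⟨a, b, ha, hb, hab, h1, h2⟩ := h
    refine ⟨a, b, ha, hb, hab, ?_, backLE_square hd (by omega) hk1 hk2 h2⟩
    by_cases hf : f = 0
    · subst hf
      intro m hm
      obtain rfl : m = 0 := by omega
      simp
    · exact frontLE_square hd (by omega) hk1 hk2 (by tauto)
  by_cases h0 : k1 + k2 = 2 * d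
  · exact ⟨d, d, by omega⟩
  by_cases h1 : k1 + k2 + 1 = 2 * d
  · exact ⟨d, d - 1, by omega⟩
  by_cases hk : k1 + k2 ≤ 1
  · exact ⟨0, k1 + k2, by omega⟩
  obtain rfl | rfl | rfl : f = 0 ∨ f = 1 ∨ f = 2 := by omega
  · by_cases h : k1 + k2 ≤ d - 1
    · exact ⟨0, k1 + k2, by omega⟩
    · exact ⟨k1 + k2 - (d - 1), d - 1, by omega⟩
  · by_cases h : k1 + k2 ≤ d
    · exact ⟨1, k1 + k2 - 1, by omega⟩
    · exact ⟨k1 + k2 - (d - 1), d - 1, by omega⟩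
  · by_cases h : k1 + k2 ≤ d
    · exact ⟨k1 + k2 - 1, 1, by omega⟩
    · exact ⟨d - 1, k1 + k2 - (d - 1), by omega⟩

end Square

/-! ### Assembling (B) and (C) -/

section Main

variable {d1 d2 : ℕ}

theorem weakMaj_trSum (C : Matrix (Fin d1 × Fin d2) (Fin d1 × Fin d2) ℂ)
    (h : ∀ k1 k2, k1 ≤ d2 → k2 ≤ d1 → ∃ a b, a ≤ d2 ∧ b ≤ d1 ∧ a + b = k1 + k2 ∧
      0 ≤ ∑ n ∈ Finset.range (d1 * d2),
        singSeq C n * (wSeq d2 a b n - vSeq d1 d2 k1 k2 n)) :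
    WeakMaj (sing (trSum C)) (sing (trSum (singDiag C))) := by
  refine weakMaj_of_antitone (singSeq_antitone _) (singSeq_antitone _) fun k hk => ?_
  obtain ⟨k1, k2, hk1, hk2, hkk, hle⟩ := exists_sum_singSeq_trSum_le C (k := k) (by simpa using hk)
  obtain ⟨a, b, ha, hb, hab, h0⟩ := h k1 k2 hk1 hk2
  refine hle.trans (le_trans ?_ (sum_mul_wSeq_le C (hab.trans hkk) ha hb))
  simp only [mul_sub, Finset.sum_sub_distrib] at h0
  linarith

theorem sum_mul_sub_nonneg {σ v w : ℕ → ℝ} (hσ : Antitone σ) {s : ℝ} {N f t : ℕ}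
    (hN : f + t < N) (hs : ∀ n, f ≤ n → n + t < N → σ n = s)
    (hD : s = 0 ∨ ∑ n ∈ Finset.range N, w n = ∑ n ∈ Finset.range N, v n)
    (hf : FrontLE v w f) (hb : BackLE v w N t) :
    0 ≤ ∑ n ∈ Finset.range N, σ n * (w n - v n) := by
  obtain ⟨M, rfl⟩ : ∃ M, N = f + M + t := ⟨N - f - t, by omega⟩
  refine sum_mul_nonneg_of_const_mid hσ (s := s) (by omega) (fun n h1 h2 => hs n h1 (by omega)) ?_
    (fun m hm => ?_) (fun j hj => ?_)
  · rw [Finset.sum_sub_distrib]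
    rcases hD with h | h
    · rw [h, zero_mul]
    · rw [h, sub_self, mul_zero]
  · rw [Finset.sum_sub_distrib]
    exact sub_nonneg.2 (hf m hm)
  · rw [Finset.sum_sub_distrib]
    exact sub_nonpos.2 (hb j hj)

theorem backLE_zero (v w : ℕ → ℝ) (N : ℕ) : BackLE v w N 0 := by
  intro j hj
  obtain rfl : j = 0 := by omega
  simp

/-- On a square grid a row and a column have equally many cells, so trading one for the other
preserves the total. -/
theorem sum_wSeq_eq_sum_vSeq {d k1 k2 a b : ℕ} (hk1 : k1 ≤ d) (hk2 : k2 ≤ d) (ha : a ≤ d)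
    (hb : b ≤ d) (hab : a + b = k1 + k2) :
    ∑ n ∈ Finset.range (d * d), wSeq d a b n = ∑ n ∈ Finset.range (d * d), vSeq d d k1 k2 n := by
  rw [sum_range_wSeq ha hb, sum_range_vSeq_total hk1 hk2, ← add_mul, ← add_mul]
  congr 1
  exact_mod_cast hab

theorem weakMaj_trSum_of_square {d : ℕ} (hd : 2 ≤ d)
    (C : Matrix (Fin d × Fin d) (Fin d × Fin d) ℂ) {n : ℕ} (hn1 : 1 ≤ n) (hn4 : n ≤ 4) {s : ℝ}
    (hs : ∀ i, i < d * d → n ≤ i + 1 → i + 1 ≤ d ^ 2 - 4 + n → singSeq C i = s) :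
    WeakMaj (sing (trSum C)) (sing (trSum (singDiag C))) := by
  have hdd : 4 ≤ d * d := by nlinarith
  rw [sq] at hs
  refine weakMaj_trSum C fun k1 k2 hk1 hk2 => ?_
  -- Here all exceptional positions fit in the front three; for `d = 2` the one remaining singular
  -- value is trivially constant.
  by_cases h : d = 2 ∨ n = 4
  · obtain ⟨a, b, ha, hb, hab, hF⟩ := exists_frontLE_three hd hd (Or.inl le_rfl) hk1 hk2
    refine ⟨a, b, ha, hb, hab, sum_mul_sub_nonneg (singSeq_antitone C) (s := singSeq C 3) (t := 0)
      (by omega) (fun i h1 h2 => ?_) (Or.inr (sum_wSeq_eq_sum_vSeq hk1 hk2 ha hb hab)) hF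
      (backLE_zero _ _ _)⟩
    rcases h with rfl | rfl
    · obtain rfl : i = 3 := by omega
      rfl
    · rw [hs i (by omega) (by omega) (by omega), hs 3 (by omega) (by omega) (by omega)]
  · obtain ⟨a, b, ha, hb, hab, hF, hB⟩ := exists_frontLE_backLE_square (f := n - 1) (t := 4 - n)
      (by omega : 3 ≤ d) (by omega) (by omega) hk1 hk2
    exact ⟨a, b, ha, hb, hab, sum_mul_sub_nonneg (singSeq_antitone C) (s := s)
      (by omega) (fun i h1 h2 => hs i (by omega) (by omega) (by omega))
      (Or.inr (sum_wSeq_eq_sum_vSeq hk1 hk2 ha hb hab)) hF hB⟩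

theorem weakMaj_trSum_of_rank_le_three (hd1 : 2 ≤ d1) (hd2 : 2 ≤ d2)
    (C : Matrix (Fin d1 × Fin d2) (Fin d1 × Fin d2) ℂ) (hC : C.rank ≤ 3)
    (h : d1 ≤ d2 ∨ 3 ≤ d2) : WeakMaj (sing (trSum C)) (sing (trSum (singDiag C))) := by
  have hdd : 4 ≤ d1 * d2 := by nlinarith
  refine weakMaj_trSum C fun k1 k2 hk1 hk2 => ?_
  obtain ⟨a, b, ha, hb, hab, hF⟩ := exists_frontLE_three hd1 hd2 h hk1 hk2
  -- The constant value is `0`, so the totals of `v` and `w` need not agree; this permits `d1 ≠ d2`.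
  exact ⟨a, b, ha, hb, hab, sum_mul_sub_nonneg (singSeq_antitone C) (s := 0) (t := 0)
    (by omega) (fun i h1 _ => singSeq_eq_zero_of_rank_le C (hC.trans h1)) (Or.inl rfl) hF
    (backLE_zero _ _ _)⟩

theorem weakMaj_trSum_of_const_mid (hd1 : 2 ≤ d1) (hd2 : 2 ≤ d2)
    (C : Matrix (Fin d1 × Fin d2) (Fin d1 × Fin d2) ℂ) {s : ℝ}
    (hs : ∀ i, 1 ≤ i → i + 1 < d1 * d2 → singSeq C i = s) :
    WeakMaj (sing (trSum C)) (sing (trSum (singDiag C))) := by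
  have hdd : 4 ≤ d1 * d2 := by nlinarith
  -- No exchange is needed: with one exceptional position at each end, the original `k1, k2` already
  -- work.
  refine weakMaj_trSum C fun k1 k2 hk1 hk2 => ⟨k1, k2, hk1, hk2, rfl,
    sum_mul_sub_nonneg (singSeq_antitone C) (s := s) (f := 1) (t := 1) (by omega) hs
      (Or.inr (by rw [sum_range_wSeq hk1 hk2, sum_range_vSeq_total hk1 hk2])) ?_ ?_⟩
  · intro m hm
    obtain ⟨h1, h2, h3⟩ := sum_range_vSeq_le hk1 hk2 m
    obtain rfl | rfl : m = 0 ∨ m = 1 := by omega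
    · simp
    · rw [Finset.sum_range_one, Finset.sum_range_one] at *
      rw [wSeq_front (by omega)]
      rcases Nat.eq_zero_or_pos k1 with rfl | h4 <;> rcases Nat.eq_zero_or_pos k2 with rfl | h5 <;>
        simp [*] at * <;> linarith
  · intro j hj
    obtain ⟨h1, h2, h3⟩ := le_sum_range_vSeq_back (j := j) hk1 hk2 (by omega)
    obtain rfl | rfl : j = 0 ∨ j = 1 := by omega
    · simp
    · rw [Finset.sum_range_one, Finset.sum_range_one] at *
      rw [wSeq_back (by omega) (by omega)]
      rcases hk1.eq_or_lt with rfl | h4 <;> rcases hk2.eq_or_lt with rfl | h5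
      · simp only [Nat.sub_self, zero_mul, Nat.cast_zero] at h3
        split_ifs <;> norm_num at * <;> linarith
      · rw [Nat.sub_self, zero_mul, Nat.cast_zero] at h2
        rw [if_neg (show ¬ d1 - 1 < k2 by omega)]
        split_ifs <;> norm_num at * <;> linarith
      · rw [Nat.sub_self, mul_zero, Nat.cast_zero] at h2
        rw [if_neg (show ¬ d2 - 1 - 0 < k1 by omega)]
        split_ifs <;> norm_num at * <;> linarith
      · rw [if_neg (by omega), if_neg (by omega)]
        simpa using h1

end Main

end PartialTraceSVD

theorem mainTheorem11 :
    (∀ (d1 d2 k1 k2 : ℕ) (hk1 : k1 ≤ d2) (hk2 : k2 ≤ d1)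
      (W : Fin k1 → Matrix.unitaryGroup (Fin d1) ℂ)
      (W' : Fin k2 → Matrix.unitaryGroup (Fin d2) ℂ),
      PartialTraceSVD.WeakMaj (PartialTraceSVD.sing (PartialTraceSVD.sOp hk1 hk2 W W'))
        (PartialTraceSVD.vVec d1 d2 k1 k2)) ∧
    (∀ (d : ℕ), 2 ≤ d → ∀ C : Matrix (Fin d × Fin d) (Fin d × Fin d) ℂ,
      (∃ n : ℕ, 1 ≤ n ∧ n ≤ 4 ∧ ∃ s : ℝ, ∀ i : Fin (Fintype.card (Fin d × Fin d)),
        n ≤ (i : ℕ) + 1 → (i : ℕ) + 1 ≤ d ^ 2 - 4 + n → PartialTraceSVD.sing C i = s) →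
      PartialTraceSVD.WeakMaj (PartialTraceSVD.sing (PartialTraceSVD.trSum C))
        (PartialTraceSVD.sing (PartialTraceSVD.trSum (PartialTraceSVD.singDiag C)))) ∧
    (∀ (d1 d2 : ℕ), 2 ≤ d1 → 2 ≤ d2 →
      ∀ C : Matrix (Fin d1 × Fin d2) (Fin d1 × Fin d2) ℂ,
      ((C.rank ≤ 3 ∧ (d1 ≤ d2 ∨ 3 ≤ d2)) ∨
        (∃ s : ℝ, ∀ i : Fin (Fintype.card (Fin d1 × Fin d2)),
          2 ≤ (i : ℕ) + 1 → (i : ℕ) + 1 ≤ d1 * d2 - 1 → PartialTraceSVD.sing C i = s)) →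
      PartialTraceSVD.WeakMaj (PartialTraceSVD.sing (PartialTraceSVD.trSum C))
        (PartialTraceSVD.sing (PartialTraceSVD.trSum (PartialTraceSVD.singDiag C)))) := by
  refine ⟨fun d1 d2 k1 k2 hk1 hk2 W W' => PartialTraceSVD.weakMaj_sOp hk1 hk2 W W',
    fun d hd C => ?_, fun d1 d2 hd1 hd2 C => ?_⟩
  · rintro ⟨n, hn1, hn4, s, hs⟩
    exact PartialTraceSVD.weakMaj_trSum_of_square hd C hn1 hn4
      fun i hi h1 h2 => hs ⟨i, by simpa using hi⟩ h1 h2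
  · rintro (⟨hC, h⟩ | ⟨s, hs⟩)
    · exact PartialTraceSVD.weakMaj_trSum_of_rank_le_three hd1 hd2 C hC h
    · refine PartialTraceSVD.weakMaj_trSum_of_const_mid hd1 hd2 C (s := s) fun i h1 h2 => ?_
      exact hs ⟨i, by simp only [Fintype.card_prod, Fintype.card_fin]; omega⟩ (Nat.succ_le_succ h1)
        (by simp only; omega)
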